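/- **Theorem (Properties of precision).** *Conventions.* For a relation $\sqsubseteq$ on $X$, $x$ is *self-precise* if $x\sqsubseteq x$; $x\equiv y$ means $x\sqsubseteq y$ and $y\sqsubseteq x$. A *partial preorder* is a transitive relation such that $x\sqsubseteq y$ implies $x\sqsubseteq x$ and $y\sqsubseteq y$. An element is *greatest* if it is self-precise and above every self-precise element. Functions $f:X\to Y$, $g:Y\to X$ form an *embedding-projection pair* if both are monotone, $f x\sqsubseteq y\Leftrightarrow x\sqsubseteq g y$ for self-precise $x,y$, and $g(f x)\sqsubseteq x$ for self-precise $x$. Let $A$ carry a partial preorder, and let $B$ be a family over $A$ with a relation on each $B\,a$ and with functions $\uparrow_{a,a'}:B\,a\to B\,a'$, $\downarrow_{a,a'}:B\,a'\to B\,a$. $B$ is an *indexed partial preorder* if: $B\,a$ is a partial preorder for $a$ self-precise; $(\uparrow_{a,a'},\downarrow_{a,a'})$ is an embedding-projection pair for $a\sqsubseteq a'$; $\uparrow_{a,a}b\equiv b\equiv\downarrow_{a,a}b$ for $a,b$ self-precise; and, for $a_0\sqsubseteq a_1\sqsubseteq a_2$, $\uparrow_{a_1,a_2}\uparrow_{a_0,a_1}b\equiv\uparrow_{a_0,a_2}b$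 for self-precise $b\in B\,a_0$ and $\downarrow_{a_0,a_1}\downarrow_{a_1,a_2}b\equiv\downarrow_{a_0,a_2}b$ for self-precise $b\in B\,a_2$. *The model.* Fix an ambient universe $\mathrm{Type}$. For $i=0,1,2,\dots$ the universe $U_i$ consists of pairs of a type $X\in\mathrm{Type}$ and a code for $X$, with $\mathrm{El}(X,c)=X$. The codes are inductively generated by: natural numbers $\mathbb N$; lists $\mathbb L A$; dependent products $\Pi A B$ ($A\in U_i$, $B:\mathrm{El}A\to U_i$), decoded as the type of dependent functions; the error type $\mathrm{err}$ (decoded as the unit type); the unknown type $?_i$; for $i=0$ the type $\mathbb P$ of propositions and $\mathrm{Box}\,p$ for a proposition $p$; for $i>0$ the preceding universe $\square$ (decoded as $U_{i-1}$) and the lifting $\iota A$ of $A\in U_{i-1}$ (decoded as $\mathrm{El}A$). (Formally one uses a copy of $U_{i-1}$ in $\mathrm{Type}$; $\mathrm{Type}$ is assumed large enough for every $U_j$, $j<i$, to be equivalent to a type in it.) $\mathbb N$, $\mathbb L A$ and $\mathrm{Box}\,p$ are inductive types with two additional constructors $\mathrm{err}$ and $?$. $\mathrm{El}(?_i)$ is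 inductively generated by $\mathrm{err}$, $?$, and injections of $\mathbb N$, of lists of elements of $\mathrm{El}(?_i)$, of $\mathbb P$ ($i=0$), of the elements of $U_{i-1}$, and of pairs $(A,a)$ with $A\in U_{i-1}$, $a\in\mathrm{El}A$ ($i>0$). Every type $A$ has elements $\mathrm{err}_A$ and $?_A$: the constructors on inductive types and on $?_i$, defined pointwise on $\Pi$, those of $A$ on $\iota A$, the codes $\mathrm{err}$ and $?_{i-1}$ on $\square$, the point of the unit type on $\mathrm{err}$, falsity and truth on $\mathbb P$. The cast $\langle A\Rightarrow B\rangle:\mathrm{El}A\to\mathrm{El}B$ is: the identity for $A=B\in\{\mathbb N,\mathbb P,\square,?_i\}$; elementwise for two list types (preserving $\mathrm{err}$ and $?$); $f\mapsto\lambda y.\langle B_1(\bar y)\Rightarrow B_2(y)\rangle f(\bar y)$ with $\bar y=\langle A_2\Rightarrow A_1\rangle y$ from $\Pi A_1B_1$ to $\Pi A_2B_2$; the cast of $U_{i-1}$ between two liftings. A cast into $?_i$ is the injection for $\mathbb N,\mathbb P,\square,\iota A$, and for $\mathbb L A$ it is the elementwise cast to $\mathbb L\,?_i$ followed by the injection.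 A cast from $?_i$ to $B\neq{?_i}$ preserves $\mathrm{err}$ and $?$; it inverts the injection for $\mathbb N,\mathbb P,\square$; it casts elementwise the injected lists for $B=\mathbb L B'$; it sends $(A,a)$ to $\langle A\Rightarrow B'\rangle a$ for $B=\iota B'$; it sends all other elements to $\mathrm{err}_B$. All other casts are constantly $\mathrm{err}_B$. *Term precision* $\sqsubseteq_A$ on $\mathrm{El}A$, together with its heterogeneous version $a\sqsubseteq_{A,B}b:\Leftrightarrow a\sqsubseteq_A\langle B\Rightarrow A\rangle b\wedge b\sqsubseteq_Bb$, is defined by recursion on codes. It is total on the error type, $\mathbb P$ and $\mathrm{Box}\,p$. On $\mathbb N$ and $\mathbb L A$ it is generated by congruence of the constructors (including $\mathrm{err}$ and $?$) and by $\mathrm{err}\sqsubseteq x\sqsubseteq{?}$ for $x$ self-precise. On $\iota A$ it is that of $A$. On $\square$ it is term precision on $U_{i-1}$, defined below. On $\Pi AB$, $f\sqsubseteq g$ iff for all $a_0\sqsubseteq_Aa_1$: $fa_0\sqsubseteq_{Ba_0,Ba_1}fa_1$, $ga_0\sqsubseteq_{Ba_0,Ba_1}ga_1$ and $fa_0\sqsubseteq_{Ba_0,Ba_1}ga_1$.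 On $?_i$ it is generated by $\mathrm{err}\sqsubseteq\mathrm{err}$, ${?}\sqsubseteq{?}$, $x\sqsubseteq{?}$ for $x$ self-precise, $e\sqsubseteq x$ for $x$ self-precise and $e$ an error, congruence of the injections of $\mathbb N$, lists, $\mathbb P$ and $U_{i-1}$, and $(A,a)\sqsubseteq(B,b)$ if $A,B$ are self-precise for type precision and $a\sqsubseteq_{A,B}b$. Here the *errors* of $?_i$ are $\mathrm{err}$ and the injections of those elements $a$ of a summand $X$ with $a\sqsubseteq\mathrm{err}_X$ (with $A$ self-precise for type precision in the case of $(A,a)$). *Type precision* $A\sqsubseteq B$ on $U_i$ is inductively generated by: reflexivity on $\mathbb N,\mathbb P,\square,?_i,\mathrm{err}$; $\mathrm{Box}\,p\sqsubseteq\mathrm{Box}\,q$; $\mathrm{err}\sqsubseteq A$ if $A\sqsubseteq A$; $\mathbb L A\sqsubseteq\mathbb L B$ if $A\sqsubseteq B$; $\iota A\sqsubseteq\iota B$ if $A\sqsubseteq B$ in $U_{i-1}$; $\mathbb N,\mathbb P,\square\sqsubseteq{?_i}$; $\mathbb L A\sqsubseteq{?_i}$ if $A\sqsubseteq{?_i}$;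 $\iota A\sqsubseteq{?_i}$ if $A\sqsubseteq A$ in $U_{i-1}$; and $\Pi AB\sqsubseteq\Pi A'B'$ if $A\sqsubseteq A'$, $a_0\sqsubseteq_Aa_1\Rightarrow Ba_0\sqsubseteq Ba_1$, $a'_0\sqsubseteq_{A'}a'_1\Rightarrow B'a'_0\sqsubseteq B'a'_1$ and $a\sqsubseteq_{A,A'}a'\Rightarrow Ba\sqsubseteq B'a'$. *Term precision on the universe* is $A\sqsubseteq_{U_i}B:\Leftrightarrow A\sqsubseteq B\wedge B\sqsubseteq{?_i}$. *Statement.* For every $i$, $U_i$ is a partial preorder both for type precision and for term precision; for each of these two relations, the family $\mathrm{El}$ over $U_i$ with the relations $\sqsubseteq_A$ and with $\uparrow_{A,B}=\langle A\Rightarrow B\rangle$, $\downarrow_{A,B}=\langle B\Rightarrow A\rangle$ is an indexed partial preorder; and $?_i$ is a greatest element of $U_i$ for term precision. -/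

import Mathlib

universe u v w

noncomputable section

namespace Grip

/-! ### Partial preorders, embedding-projection pairs, indexed partial preorders -/

/-- A partial preorder: a transitive and quasi-reflexive relation.
`x` is self-precise when `r x x`. -/
structure IsPartialPreorder {X : Type v} (r : X → X → Prop) : Prop where
  trans : ∀ x y z, r x y → r y z → r x z
  left_refl : ∀ x y, r x y → r x x
  right_refl : ∀ x y, r x y → r y y

/-- Equiprecision. -/
def Equi {X : Type v} (r : X → X → Prop) (x y : X) : Prop := r x y ∧ r y x

/-- `x` is a greatest element of a partial preorder: it is self-precise and above every
self-precise element. -/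
def IsGreatestElt {X : Type v} (r : X → X → Prop) (x : X) : Prop :=
  r x x ∧ ∀ y, r y y → r y x

/-- `(up, down)` is an embedding-projection pair; everything is relative to self-precise
elements. -/
structure IsEPPair {X : Type v} {Y : Type w} (rX : X → X → Prop) (rY : Y → Y → Prop)
    (up : X → Y) (down : Y → X) : Prop where
  mono_up : ∀ x x', rX x x' → rY (up x) (up x')
  mono_down : ∀ y y', rY y y' → rX (down y) (down y')
  adjunction : ∀ x y, rX x x → rY y y → (rY (up x) y ↔ rX x (down y))
  retraction : ∀ x, rX x x → rX (down (up x)) x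

/-- A type family `B` with casts `up a a' : B a → B a'` and `down a a' : B a' → B a`, and with a
relation on every fibre, is an indexed partial preorder over `(A, r)`. -/
structure IsIndexedPartialPreorder {A : Type v} (r : A → A → Prop) (B : A → Type w)
    (rB : ∀ a, B a → B a → Prop) (up : ∀ a a', B a → B a') (down : ∀ a a', B a' → B a) :
    Prop where
  base : IsPartialPreorder r
  fibre : ∀ a, r a a → IsPartialPreorder (rB a)
  epPair : ∀ a a', r a a' → IsEPPair (rB a) (rB a') (up a a') (down a a')
  up_id : ∀ a, r a a → ∀ b, rB a b b → Equi (rB a) (up a a b) b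
  down_id : ∀ a, r a a → ∀ b, rB a b b → Equi (rB a) b (down a a b)
  up_comp : ∀ a₀ a₁ a₂, r a₀ a₁ → r a₁ a₂ → ∀ b, rB a₀ b b →
    Equi (rB a₂) (up a₁ a₂ (up a₀ a₁ b)) (up a₀ a₂ b)
  down_comp : ∀ a₀ a₁ a₂, r a₀ a₁ → r a₁ a₂ → ∀ b, rB a₂ b b →
    Equi (rB a₀) (down a₀ a₁ (down a₁ a₂ b)) (down a₀ a₂ b)

/-! ### Inductive types with two exceptional constructors, and their precision -/

/-- Natural numbers with the exceptional terms `err` and `unk`. -/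
inductive XNat : Type u
  | err : XNat
  | unk : XNat
  | zero : XNat
  | succ (n : XNat) : XNat

inductive XNat.Prec : XNat.{u} → XNat.{u} → Prop
  | err_refl : Prec .err .err
  | unk_refl : Prec .unk .unk
  | err_min {n : XNat.{u}} : Prec n n → Prec .err n
  | unk_max {n : XNat.{u}} : Prec n n → Prec n .unk
  | zero : Prec .zero .zero
  | succ {n m : XNat.{u}} : Prec n m → Prec (.succ n) (.succ m)

/-- Lists with the exceptional terms `err` and `unk`. -/
inductive XList (X : Type u) : Type u
  | err : XList X
  | unk : XList X
  | nil : XList X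
  | cons (x : X) (l : XList X) : XList X

def XList.map {X Y : Type u} (f : X → Y) : XList X → XList Y
  | .err => .err
  | .unk => .unk
  | .nil => .nil
  | .cons x l => .cons (f x) (l.map f)

inductive XList.Prec {X : Type u} (r : X → X → Prop) : XList X → XList X → Prop
  | err_refl : Prec r .err .err
  | unk_refl : Prec r .unk .unk
  | err_min {l : XList X} : Prec r l l → Prec r .err l
  | unk_max {l : XList X} : Prec r l l → Prec r l .unk
  | nil : Prec r .nil .nil
  | cons {x y : X} {l m : XList X} : r x y → Prec r l m → Prec r (.cons x l) (.cons y m)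

/-- A boxed proposition, with the exceptional terms `err` and `unk`. -/
inductive XBox (p : Prop) : Type u
  | err : XBox p
  | unk : XBox p
  | box (h : p) : XBox p

/-! ### Universe levels -/

/-- The data of a family of types `El : U → Type u` with exceptional terms, casts, homogeneous
term precision `prec A` on every `El A` and type precision `tprec` on `U`. -/
structure PreLevel : Type (max (u + 1) (v + 1)) where
  U : Type v
  El : U → Type u
  err : ∀ A, El A
  unk : ∀ A, El A
  cast : ∀ A B, El A → El B
  prec : ∀ A, El A → El A → Prop
  tprec : U → U → Prop

/-- Heterogeneous term precision. -/
def PreLevel.hprec (L : PreLevel.{u, v}) (A B : L.U) (a : L.El A) (b : L.El B) : Prop :=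
  L.prec A a (L.cast B A b) ∧ L.prec B b b

/-- A universe level also has codes for the error type and for the unknown type. -/
structure Level : Type (max (u + 1) (v + 1)) extends PreLevel.{u, v} where
  errCode : U
  unkCode : U

/-- Term precision on a universe: type precision restricted to the types bounded by the unknown
type. -/
def Level.uprec (L : Level.{u, v}) (A B : L.U) : Prop := L.tprec A B ∧ L.tprec B L.unkCode

/-- The same level with its type of codes replaced by an equivalent type. -/
def Level.copy (L : Level.{u, v}) {V : Type w} (e : V ≃ L.U) : Level.{u, w} where
  U := V
  El A := L.El (e A)
  err A := L.err (e A)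
  unk A := L.unk (e A)
  cast A B := L.cast (e A) (e B)
  prec A := L.prec (e A)
  tprec A B := L.tprec (e A) (e B)
  errCode := e.symm L.errCode
  unkCode := e.symm L.unkCode

/-- The empty family of types: there is no universe below level `0`. -/
def PreLevel.void : PreLevel.{u, u} where
  U := PEmpty
  El A := A.elim
  err A := A.elim
  unk A := A.elim
  cast A := A.elim
  prec A := A.elim
  tprec A := A.elim

/-! The next universe is built from `P`, which is `none` at level `0` and is `some L` at a level
whose preceding level is `L`. -/

/-- The types of the preceding level. -/
def low : Option Level.{u, u} → PreLevel.{u, u}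
  | none => PreLevel.void
  | some L => L.toPreLevel

def lowErrCode : (P : Option Level.{u, u}) → P.isSome → (low P).U
  | some L, _ => L.errCode

def lowUnkCode : (P : Option Level.{u, u}) → P.isSome → (low P).U
  | some L, _ => L.unkCode

/-- Term precision on the preceding universe. -/
def lowUprec : (P : Option Level.{u, u}) → (low P).U → (low P).U → Prop
  | none => fun A => A.elim
  | some L => L.uprec

variable (P : Option Level.{u, u})

/-! ### The unknown type -/

/-- The interpretation of the unknown type. It is closed under all type constructors but dependent
products: `univ` embeds the preceding universe, `cum` hosts the elements of any type of the
preceding universe, and both are void at level `0`; `prop` exists at level `0` only. -/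
inductive Unknown : Type u
  | err : Unknown
  | unk : Unknown
  | nat (n : XNat.{u}) : Unknown
  | list (l : XList Unknown) : Unknown
  | prop (h : P = none) (p : Prop) : Unknown
  | univ (A : (low P).U) : Unknown
  | cum (A : (low P).U) (a : (low P).El A) : Unknown

/-- The errors of the unknown type: its own error, and the injections of the elements of a summand
that are below the error of that summand. -/
inductive Unknown.IsErr : Unknown P → Prop
  | err : IsErr .err
  | nat {n : XNat.{u}} : n.Prec .err → IsErr (.nat n)
  | list : IsErr (.list .err)
  | prop (h : P = none) (p : Prop) : IsErr (.prop h p)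
  | univ {A : (low P).U} (h : P.isSome) : lowUprec P A (lowErrCode P h) → IsErr (.univ A)
  | cum {A : (low P).U} {a : (low P).El A} :
      (low P).tprec A A → (low P).prec A a ((low P).err A) → IsErr (.cum A a)

/-- Precision on the unknown type. -/
inductive Unknown.Prec : Unknown P → Unknown P → Prop
  | err_refl : Prec .err .err
  | unk_refl : Prec .unk .unk
  | err_min {x y : Unknown P} : IsErr P x → Prec y y → Prec x y
  | unk_max {x : Unknown P} : Prec x x → Prec x .unk
  | nat {n m : XNat.{u}} : n.Prec m → Prec (.nat n) (.nat m)
  | list {l m : XList (Unknown P)} : XList.Prec Prec l m → Prec (.list l) (.list m)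
  | prop (h h' : P = none) (p q : Prop) : Prec (.prop h p) (.prop h' q)
  | univ {A B : (low P).U} : lowUprec P A B → Prec (.univ A) (.univ B)
  | cum {A B : (low P).U} {a : (low P).El A} {b : (low P).El B} :
      (low P).tprec A A → (low P).tprec B B → (low P).hprec A B a b → Prec (.cum A a) (.cum B b)

/-! ### Codes -/

/-- `Code P X` is the type of codes for the type `X`. -/
inductive Code : Type u → Type (u + 1)
  | nat : Code XNat.{u}
  | list {X : Type u} (c : Code X) : Code (XList X)
  | pi {X : Type u} {Y : X → Type u} (c : Code X) (d : ∀ x, Code (Y x)) : Code (∀ x, Y x)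
  | err : Code PUnit.{u + 1}
  | unk : Code (Unknown P)
  | prop (h : P = none) : Code (ULift.{u} Prop)
  | box (h : P = none) (p : Prop) : Code (XBox.{u} p)
  | univ (h : P.isSome) : Code (low P).U
  | cum (A : (low P).U) : Code ((low P).El A)

variable {P}

/-- The error of every type. -/
def Code.errOf : {X : Type u} → Code P X → X
  | _, .nat => .err
  | _, .list _ => .err
  | _, .pi _ d => fun x => (d x).errOf
  | _, .err => ⟨⟩
  | _, .unk => .err
  | _, .prop _ => ⟨False⟩
  | _, .box _ _ => .err
  | _, .univ h => lowErrCode P h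
  | _, .cum A => (low P).err A

/-- The unknown term of every type. -/
def Code.unkOf : {X : Type u} → Code P X → X
  | _, .nat => .unk
  | _, .list _ => .unk
  | _, .pi _ d => fun x => (d x).unkOf
  | _, .err => ⟨⟩
  | _, .unk => .unk
  | _, .prop _ => ⟨True⟩
  | _, .box _ _ => .unk
  | _, .univ h => lowUnkCode P h
  | _, .cum A => (low P).unk A

/-- The cast from a type to the unknown type. -/
def Code.toUnk : {X : Type u} → Code P X → X → Unknown P
  | _, .nat => fun n => .nat n
  | _, .list c => fun l => .list (l.map c.toUnk)
  | _, .pi _ _ => fun _ => .err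
  | _, .err => fun _ => .err
  | _, .unk => fun x => x
  | _, .prop h => fun p => .prop h p.down
  | _, .box _ _ => fun _ => .err
  | _, .univ _ => fun A => .univ A
  | _, .cum A => fun a => .cum A a

/-- The cast from the unknown type to a type: it preserves the two exceptional terms, extracts the
elements that come from the same type constructor, and fails on the others. -/
def Code.ofUnk : {X : Type u} → Code P X → Unknown P → X
  | _, .nat => fun
    | .nat n => n
    | .unk => .unk
    | _ => .err
  | _, .list c => fun
    | .list l => l.map c.ofUnk
    | .unk => .unk
    | _ => .err
  | _, .pi c d => fun
    | .unk => (Code.pi c d).unkOf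
    | _ => (Code.pi c d).errOf
  | _, .err => fun _ => ⟨⟩
  | _, .unk => fun x => x
  | _, .prop h => fun
    | .prop _ p => ⟨p⟩
    | .unk => (Code.prop h).unkOf
    | _ => (Code.prop h).errOf
  | _, .box _ _ => fun
    | .unk => .unk
    | _ => .err
  | _, .univ h => fun
    | .univ A => A
    | .unk => lowUnkCode P h
    | _ => lowErrCode P h
  | _, .cum A => fun
    | .cum B b => (low P).cast B A b
    | .unk => (low P).unk A
    | _ => (low P).err A

/-- The casts in both directions between two types. On products the domain is cast
contravariantly, which is why the two directions are defined together. Casts between types with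
distinct head constructors fail, and so do all casts between boxed propositions. -/
def Code.castPair : {X : Type u} → Code P X → {Y : Type u} → Code P Y → (X → Y) × (Y → X)
  | _, .unk, _, d => (d.ofUnk, d.toUnk)
  | _, .nat, _, .nat => (fun n => n, fun n => n)
  | _, .list c, _, .list d => (XList.map (c.castPair d).1, XList.map (c.castPair d).2)
  | _, .pi c₀ c₁, _, .pi d₀ d₁ =>
    (fun f y => ((c₁ ((c₀.castPair d₀).2 y)).castPair (d₁ y)).1 (f ((c₀.castPair d₀).2 y)),
     fun g x => ((c₁ x).castPair (d₁ ((c₀.castPair d₀).1 x))).2 (g ((c₀.castPair d₀).1 x)))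
  | _, .prop _, _, .prop _ => (fun p => p, fun p => p)
  | _, .univ _, _, .univ _ => (fun A => A, fun A => A)
  | _, .cum A, _, .cum B => ((low P).cast A B, (low P).cast B A)
  | _, c, _, .unk => (c.toUnk, c.ofUnk)
  | _, c, _, d => (fun _ => d.errOf, fun _ => c.errOf)

/-- The cast from the type coded by `c` to the type coded by `d`. -/
def Code.cast {X Y : Type u} (c : Code P X) (d : Code P Y) : X → Y := (c.castPair d).1

/-- Homogeneous term precision. On products it uses heterogeneous precision on the codomains. -/
def Code.prec : {X : Type u} → Code P X → X → X → Prop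
  | _, .nat => XNat.Prec
  | _, .list c => XList.Prec c.prec
  | _, .pi c d => fun f g =>
    (∀ x₀ x₁, c.prec x₀ x₁ →
      (d x₀).prec (f x₀) ((d x₁).cast (d x₀) (f x₁)) ∧ (d x₁).prec (f x₁) (f x₁)) ∧
    (∀ x₀ x₁, c.prec x₀ x₁ →
      (d x₀).prec (g x₀) ((d x₁).cast (d x₀) (g x₁)) ∧ (d x₁).prec (g x₁) (g x₁)) ∧
    (∀ x₀ x₁, c.prec x₀ x₁ →
      (d x₀).prec (f x₀) ((d x₁).cast (d x₀) (g x₁)) ∧ (d x₁).prec (g x₁) (g x₁))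
  | _, .err => fun _ _ => True
  | _, .unk => Unknown.Prec P
  | _, .prop _ => fun _ _ => True
  | _, .box _ _ => fun _ _ => True
  | _, .univ _ => lowUprec P
  | _, .cum A => (low P).prec A

/-- Heterogeneous term precision. -/
def Code.hprec {X Y : Type u} (c : Code P X) (d : Code P Y) (x : X) (y : Y) : Prop :=
  c.prec x (d.cast c y) ∧ d.prec y y

/-- Type precision. -/
inductive Code.TPrec : {X Y : Type u} → Code P X → Code P Y → Prop
  | nat : TPrec .nat .nat
  | nat_unk : TPrec .nat .unk
  | list {X Y : Type u} {c : Code P X} {d : Code P Y} : TPrec c d → TPrec (.list c) (.list d)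
  | list_unk {X : Type u} {c : Code P X} : TPrec c .unk → TPrec (.list c) .unk
  | pi {X : Type u} {Y : X → Type u} {X' : Type u} {Y' : X' → Type u}
      {c : Code P X} {d : ∀ x, Code P (Y x)} {c' : Code P X'} {d' : ∀ x, Code P (Y' x)} :
      TPrec c c' →
      (∀ x₀ x₁, c.prec x₀ x₁ → TPrec (d x₀) (d x₁)) →
      (∀ x₀ x₁, c'.prec x₀ x₁ → TPrec (d' x₀) (d' x₁)) →
      (∀ x x', c.hprec c' x x' → TPrec (d x) (d' x')) →
      TPrec (.pi c d) (.pi c' d')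
  | err_refl : TPrec .err .err
  | err_min {X : Type u} {c : Code P X} : TPrec c c → TPrec .err c
  | unk_refl : TPrec .unk .unk
  | prop (h : P = none) : TPrec (.prop h) (.prop h)
  | prop_unk (h : P = none) : TPrec (.prop h) .unk
  | box (h : P = none) (p q : Prop) : TPrec (.box h p) (.box h q)
  | univ (h : P.isSome) : TPrec (.univ h) (.univ h)
  | univ_unk (h : P.isSome) : TPrec (.univ h) .unk
  | cum {A B : (low P).U} : (low P).tprec A B → TPrec (.cum A) (.cum B)
  | cum_unk {A : (low P).U} : (low P).tprec A A → TPrec (.cum A) .unk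

/-! ### The hierarchy -/

/-- The universe of codes on top of `P`: a code is a type together with a code for it, and the
decoding is the first projection. -/
def next (P : Option Level.{u, u}) : Level.{u, u + 1} where
  U := Σ X : Type u, Code P X
  El A := A.1
  err A := A.2.errOf
  unk A := A.2.unkOf
  cast A B := A.2.cast B.2
  prec A := A.2.prec
  tprec A B := A.2.TPrec B.2
  errCode := ⟨_, .err⟩
  unkCode := ⟨_, .unk⟩

open Classical in
/-- What level `i` is built on: nothing for `i = 0`, and for `i = j + 1` a copy of level `j` whose
type of codes lies in `Type u`. This needs the codes of level `j` to form a `u`-small type;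
`below (j + 1)` has no meaning otherwise. -/
def below : ℕ → Option Level.{u, u}
  | 0 => none
  | j + 1 =>
    if h : Small.{u} (next (below j)).U then
      some ((next (below j)).copy (equivShrink (next (below j)).U).symm)
    else none

/-- The `i`-th level of the hierarchy. -/
def level (i : ℕ) : Level.{u, u + 1} := next (below i)

/-- The `i`-th universe of codes. -/
abbrev Univ (i : ℕ) : Type (u + 1) := (level.{u} i).U

variable {i : ℕ}

/-- The decoding family of the `i`-th universe. -/
abbrev El (A : Univ.{u} i) : Type u := (level.{u} i).El A

/-- The cast between two types of the `i`-th universe. -/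
abbrev cast (A B : Univ.{u} i) : El A → El B := (level.{u} i).cast A B

/-- Homogeneous precision on the elements of a type of the `i`-th universe. -/
abbrev prec (A : Univ.{u} i) : El A → El A → Prop := (level.{u} i).prec A

/-- Type precision on the `i`-th universe. -/
abbrev typePrec (A B : Univ.{u} i) : Prop := (level.{u} i).tprec A B

/-- Term precision on the `i`-th universe. -/
abbrev termPrec (A B : Univ.{u} i) : Prop := (level.{u} i).uprec A B

/-- The code of the unknown type of the `i`-th universe. -/
abbrev unknown (i : ℕ) : Univ.{u} i := (level.{u} i).unkCode

end Grip

end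

/-! Two casts in a row can only lose precision: ⟨B⇒C⟩⟨A⇒B⟩a ⊑ ⟨A⇒C⟩a for all self-precise types A,
B, C, related or not. Nothing is lost when the middle type B is above the source or above the
target. These are the laws `lax`, `up` and `down` of `Good`. Together with monotonicity and ⟨A⇒A⟩ ≡
id they yield the embedding-projection pairs (`Good.isEPPair`) and both composition laws.

Keeping the third type arbitrary is what makes the laws stable under dependent products. Casts are
contravariant in the domain, so `up` for a product uses `down` on the domain and `up` on the
codomains, and symmetrically for `down`. An arbitrary middle type in `lax` is also needed for the
unknown type, whose pairs (A, a) and (B, b) are compared without any relation between A and B.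

The unknown type is built from the preceding level only, so its preorder laws follow from that
level. They rest on errors being downward closed (`Unknown.IsErr.of_prec`). A cast that fails
returns an error, which is least, so only matching head constructors require work.

The laws for three codes need only the laws for their immediate subcodes, and for ? in the case of
lists (`Code.good_subMem`). Induction on an ordinal rank gives them for all self-precise codes of a
level (`good_next`), and induction on the level gives the hierarchy. Quasi-reflexivity of type
precision comes only after `good_next`, since its product case uses ⟨A⇒A⟩ ≡ id; this is why `Good`
is relative to a class of self-precise types. -/

namespace Grip

/-! ### Precision on numbers and lists -/

theorem XNat.Prec.quasi {n m : XNat.{u}} (h : n.Prec m) : n.Prec n ∧ m.Prec m := by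
  induction h with
  | err_refl => exact ⟨.err_refl, .err_refl⟩
  | unk_refl => exact ⟨.unk_refl, .unk_refl⟩
  | err_min h _ => exact ⟨.err_refl, h⟩
  | unk_max h _ => exact ⟨h, .unk_refl⟩
  | zero => exact ⟨.zero, .zero⟩
  | succ _ ih => exact ⟨.succ ih.1, .succ ih.2⟩

theorem XNat.Prec.trans {n m k : XNat.{u}} (h : n.Prec m) (h' : m.Prec k) : n.Prec k := by
  induction h generalizing k with
  | err_refl => exact h'
  | unk_refl => exact h'
  | err_min _ _ => exact .err_min h'.quasi.2
  | unk_max h _ => cases h' <;> exact .unk_max h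
  | zero => exact h'
  | succ h ih =>
    cases h' with
    | unk_max => exact .unk_max (XNat.Prec.succ h).quasi.1
    | succ h' => exact .succ (ih h')

section XList

variable {X Y Z : Type u} {q r : X → X → Prop} {s : Y → Y → Prop}

/-- The relations `q` and `r` are kept apart so that `q` can carry the induction hypothesis of a
derivation on the unknown type, where lists occur nested. -/
theorem XList.Prec.quasi_of (hq : ∀ x y, q x y → r x x ∧ r y y) {l m : XList X}
    (h : XList.Prec q l m) : XList.Prec r l l ∧ XList.Prec r m m := by
  induction h with
  | err_refl => exact ⟨.err_refl, .err_refl⟩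
  | unk_refl => exact ⟨.unk_refl, .unk_refl⟩
  | err_min _ ih => exact ⟨.err_refl, ih.1⟩
  | unk_max _ ih => exact ⟨ih.1, .unk_refl⟩
  | nil => exact ⟨.nil, .nil⟩
  | cons h _ ih => exact ⟨.cons (hq _ _ h).1 ih.1, .cons (hq _ _ h).2 ih.2⟩

theorem XList.Prec.trans_of (hr : ∀ x y, r x y → r x x ∧ r y y)
    (hq : ∀ x y, q x y → (r x x ∧ r y y) ∧ ∀ z, r y z → r x z) {l m k : XList X}
    (h : XList.Prec q l m) (h' : XList.Prec r m k) : XList.Prec r l k := by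
  induction h generalizing k with
  | err_refl => exact h'
  | unk_refl => exact h'
  | err_min _ _ => exact .err_min (h'.quasi_of hr).2
  | unk_max h _ =>
    have hl := (h.quasi_of (r := r) fun x y h => (hq x y h).1).1
    cases h' <;> exact .unk_max hl
  | nil => exact h'
  | cons h h₁ ih =>
    cases h' with
    | unk_max h' =>
      exact .unk_max (.cons (hq _ _ h).1.1 (h₁.quasi_of (r := r) fun x y h => (hq x y h).1).1)
    | cons h₂ h' => exact .cons ((hq _ _ h).2 _ h₂) (ih h')

theorem XList.Prec.map (hs : ∀ x y, s x y → s x x ∧ s y y) {f g : X → Y}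
    (h : ∀ x y, r x y → s (f x) (g y)) {l m : XList X} (hl : XList.Prec r l m) :
    XList.Prec s (l.map f) (m.map g) := by
  induction hl with
  | err_refl => exact .err_refl
  | unk_refl => exact .unk_refl
  | err_min _ ih => exact .err_min (ih.quasi_of hs).2
  | unk_max _ ih => exact .unk_max (ih.quasi_of hs).1
  | nil => exact .nil
  | cons h' _ ih => exact .cons (h _ _ h') ih

/-- Inequalities between composite casts hold only at self-precise elements; this version lifts them
to lists, which `XList.Prec.map` cannot do. -/
theorem XList.Prec.map_self {f g : X → Y} (h : ∀ x, r x x → s (f x) (g x)) {l : XList X}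
    (hl : XList.Prec r l l) : XList.Prec s (l.map f) (l.map g) := by
  induction l with
  | err => exact .err_refl
  | unk => exact .unk_refl
  | nil => exact .nil
  | cons x l ih =>
    cases hl with
    | cons h₁ h₂ => exact .cons (h _ h₁) (ih h₂)

theorem XList.map_map (f : X → Y) (g : Y → Z) (l : XList X) :
    (l.map f).map g = l.map fun x => g (f x) := by
  induction l with
  | cons x l ih => simp [XList.map, ih]
  | _ => rfl

theorem XList.map_id (l : XList X) : (l.map fun x => x) = l := by
  induction l with
  | cons x l ih => simp [XList.map, ih]
  | _ => rfl

end XList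

/-! ### Well-behaved families of types with casts -/

/-- The laws of precision and casts for the types in a class `S` of self-precise types. -/
structure Good (L : PreLevel.{u, v}) (S : L.U → Prop) : Prop where
  tself : ∀ {A}, S A → L.tprec A A
  ttrans : ∀ {A B C}, S A → S B → S C → L.tprec A B → L.tprec B C → L.tprec A C
  trans : ∀ {A}, S A → ∀ {a b c}, L.prec A a b → L.prec A b c → L.prec A a c
  quasi : ∀ {A}, S A → ∀ {a b}, L.prec A a b → L.prec A a a ∧ L.prec A b b
  err_le : ∀ {A}, S A → ∀ {a}, L.prec A a a → L.prec A (L.err A) a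
  le_unk : ∀ {A}, S A → ∀ {a}, L.prec A a a → L.prec A a (L.unk A)
  unk_self : ∀ {A}, S A → L.prec A (L.unk A) (L.unk A)
  mono : ∀ {A B}, S A → S B → ∀ {a a'}, L.prec A a a' →
    L.prec B (L.cast A B a) (L.cast A B a')
  cast_err : ∀ {A B}, S A → S B → L.prec B (L.cast A B (L.err A)) (L.err B)
  lax : ∀ {A B C}, S A → S B → S C → ∀ {a}, L.prec A a a →
    L.prec C (L.cast B C (L.cast A B a)) (L.cast A C a)
  up : ∀ {A B C}, S A → S B → S C → L.tprec A B → ∀ {a}, L.prec A a a →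
    L.prec C (L.cast A C a) (L.cast B C (L.cast A B a))
  down : ∀ {A B C}, S A → S B → S C → L.tprec A B → ∀ {c}, L.prec C c c →
    L.prec A (L.cast C A c) (L.cast B A (L.cast C B c))
  cast_id : ∀ {A}, S A → ∀ {a}, L.prec A a a →
    L.prec A (L.cast A A a) a ∧ L.prec A a (L.cast A A a)

namespace Good

variable {L : PreLevel.{u, v}} {S : L.U → Prop} (G : Good L S) {A B C : L.U}
include G

theorem left (hA : S A) {a b : L.El A} (h : L.prec A a b) : L.prec A a a := (G.quasi hA h).1

theorem right (hA : S A) {a b : L.El A} (h : L.prec A a b) : L.prec A b b := (G.quasi hA h).2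

theorem err_self (hA : S A) : L.prec A (L.err A) (L.err A) :=
  G.left hA (G.err_le hA (G.unk_self hA))

/-- The upcast followed by the downcast is above the identity. -/
theorem unit (hA : S A) (hB : S B) (h : L.tprec A B) {a : L.El A} (ha : L.prec A a a) :
    L.prec A a (L.cast B A (L.cast A B a)) :=
  G.trans hA (G.cast_id hA ha).2 (G.up hA hB hA h ha)

/-- A cast back and forth is below the identity. -/
theorem cast_cast_le (hA : S A) (hB : S B) {a : L.El A} (ha : L.prec A a a) :
    L.prec A (L.cast B A (L.cast A B a)) a :=
  G.trans hA (G.lax hA hB hA ha) (G.cast_id hA ha).1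

/-- Makes the pointwise unknown term of a product a monotone function. -/
theorem unk_le_cast_unk (hA : S A) (hB : S B) (h : L.tprec A B) :
    L.prec A (L.unk A) (L.cast B A (L.unk B)) :=
  G.trans hA (G.unit hA hB h (G.unk_self hA))
    (G.mono hB hA (G.le_unk hB (G.mono hA hB (G.unk_self hA))))

/-- Transitivity of heterogeneous precision between unrelated types: `lax` absorbs the intermediate
cast. -/
theorem le_cast_trans (hA : S A) (hB : S B) (hC : S C) {a : L.El A} {b : L.El B} {c : L.El C}
    (hc : L.prec C c c) (h : L.prec A a (L.cast B A b)) (h' : L.prec B b (L.cast C B c)) :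
    L.prec A a (L.cast C A c) :=
  G.trans hA h (G.trans hA (G.mono hB hA h') (G.lax hC hB hA hc))

theorem isEPPair (hA : S A) (hB : S B) (h : L.tprec A B) :
    IsEPPair (L.prec A) (L.prec B) (L.cast A B) (L.cast B A) where
  mono_up _ _ h := G.mono hA hB h
  mono_down _ _ h := G.mono hB hA h
  adjunction _ _ hx hy :=
    ⟨fun h' => G.trans hA (G.unit hA hB h hx) (G.mono hB hA h'),
      fun h' => G.trans hB (G.mono hA hB h') (G.cast_cast_le hB hA hy)⟩
  retraction _ hx := G.cast_cast_le hA hB hx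

end Good

/-- Good laws for a class of types are inherited from the classes of a directed cover. -/
theorem Good.of_directed {L : PreLevel.{u, v}} {S : L.U → Prop}
    (h : ∀ A B C, S A → S B → S C → ∃ T, Good L T ∧ T A ∧ T B ∧ T C) : Good L S where
  tself {A} hA := by
    obtain ⟨T, G, hA, -, -⟩ := h A A A hA hA hA
    exact G.tself hA
  ttrans {A B C} hA hB hC := by
    obtain ⟨T, G, hA, hB, hC⟩ := h A B C hA hB hC
    exact G.ttrans hA hB hC
  trans {A} hA := by
    obtain ⟨T, G, hA, -, -⟩ := h A A A hA hA hA
    exact G.trans hA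
  quasi {A} hA := by
    obtain ⟨T, G, hA, -, -⟩ := h A A A hA hA hA
    exact G.quasi hA
  err_le {A} hA := by
    obtain ⟨T, G, hA, -, -⟩ := h A A A hA hA hA
    exact G.err_le hA
  le_unk {A} hA := by
    obtain ⟨T, G, hA, -, -⟩ := h A A A hA hA hA
    exact G.le_unk hA
  unk_self {A} hA := by
    obtain ⟨T, G, hA, -, -⟩ := h A A A hA hA hA
    exact G.unk_self hA
  mono {A B} hA hB := by
    obtain ⟨T, G, hA, hB, -⟩ := h A B B hA hB hB
    exact G.mono hA hB
  cast_err {A B} hA hB := by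
    obtain ⟨T, G, hA, hB, -⟩ := h A B B hA hB hB
    exact G.cast_err hA hB
  lax {A B C} hA hB hC := by
    obtain ⟨T, G, hA, hB, hC⟩ := h A B C hA hB hC
    exact G.lax hA hB hC
  up {A B C} hA hB hC := by
    obtain ⟨T, G, hA, hB, hC⟩ := h A B C hA hB hC
    exact G.up hA hB hC
  down {A B C} hA hB hC := by
    obtain ⟨T, G, hA, hB, hC⟩ := h A B C hA hB hC
    exact G.down hA hB hC
  cast_id {A} hA := by
    obtain ⟨T, G, hA, -, -⟩ := h A A A hA hA hA
    exact G.cast_id hA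

/-! ### Dependent products -/

section Pi

variable {L : PreLevel.{u, v}} {S : L.U → Prop}

/-- A monotone family of types over a type. -/
structure IsFam (L : PreLevel.{u, v}) (S : L.U → Prop) (A : L.U) (B : L.El A → L.U) : Prop where
  dom : S A
  cod : ∀ {x}, L.prec A x x → S (B x)
  mono : ∀ {x y}, L.prec A x y → L.tprec (B x) (B y)

/-- The comparison of two dependent functions through heterogeneous precision. -/
def PiRel (L : PreLevel.{u, v}) (A : L.U) (B : L.El A → L.U) (f g : ∀ x, L.El (B x)) : Prop :=
  ∀ x₀ x₁, L.prec A x₀ x₁ → L.hprec (B x₀) (B x₁) (f x₀) (g x₁)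

/-- Precision on dependent products. -/
def PiPrec (L : PreLevel.{u, v}) (A : L.U) (B : L.El A → L.U) (f g : ∀ x, L.El (B x)) : Prop :=
  PiRel L A B f f ∧ PiRel L A B g g ∧ PiRel L A B f g

/-- The cast between dependent products. -/
def piCast (L : PreLevel.{u, v}) (A₀ : L.U) (B₀ : L.El A₀ → L.U) (A₁ : L.U) (B₁ : L.El A₁ → L.U)
    (f : ∀ x, L.El (B₀ x)) (y : L.El A₁) : L.El (B₁ y) :=
  L.cast (B₀ (L.cast A₁ A₀ y)) (B₁ y) (f (L.cast A₁ A₀ y))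

variable (G : Good L S) {A A₀ A₁ A₂ : L.U} {B : L.El A → L.U} {B₀ : L.El A₀ → L.U}
  {B₁ : L.El A₁ → L.U} {B₂ : L.El A₂ → L.U}
include G

/-- Self-precision of `f x₁`, the second half of heterogeneous precision, comes from the first half
on the diagonal. -/
theorem Good.pi_mono_iff (F : IsFam L S A B) {f : ∀ x, L.El (B x)} :
    PiRel L A B f f ↔
      ∀ x₀ x₁, L.prec A x₀ x₁ → L.prec (B x₀) (f x₀) (L.cast (B x₁) (B x₀) (f x₁)) := by
  refine ⟨fun h x₀ x₁ hx => (h x₀ x₁ hx).1, fun h x₀ x₁ hx => ⟨h x₀ x₁ hx, ?_⟩⟩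
  have hx₁ := G.right F.dom hx
  exact G.left (F.cod hx₁) (h x₁ x₁ hx₁)

/-- For monotone functions, precision is pointwise. -/
theorem Good.pi_iff (F : IsFam L S A B) {f g : ∀ x, L.El (B x)} (hf : PiRel L A B f f)
    (hg : PiRel L A B g g) :
    PiPrec L A B f g ↔ ∀ x, L.prec A x x → L.prec (B x) (f x) (g x) := by
  constructor
  · intro h x hx
    exact G.trans (F.cod hx) (h.2.2 x x hx).1 (G.cast_id (F.cod hx) (hg x x hx).2).1
  · refine fun h => ⟨hf, hg, fun x₀ x₁ hx => ?_⟩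
    have hx₀ := G.left F.dom hx
    exact ⟨G.trans (F.cod hx₀) (h x₀ hx₀) (hg x₀ x₁ hx).1, (hg x₀ x₁ hx).2⟩

theorem Good.pi_apply (F : IsFam L S A B) {f g : ∀ x, L.El (B x)} (h : PiPrec L A B f g)
    {x : L.El A} (hx : L.prec A x x) : L.prec (B x) (f x) (g x) :=
  (G.pi_iff F h.1 h.2.1).1 h x hx

theorem Good.pi_trans (F : IsFam L S A B) {f g k : ∀ x, L.El (B x)} (h : PiPrec L A B f g)
    (h' : PiPrec L A B g k) : PiPrec L A B f k :=
  (G.pi_iff F h.1 h'.2.1).2 fun _ hx =>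
    G.trans (F.cod hx) (G.pi_apply F h hx) (G.pi_apply F h' hx)

theorem Good.pi_err_mono (F : IsFam L S A B) :
    PiRel L A B (fun x => L.err (B x)) fun x => L.err (B x) :=
  (G.pi_mono_iff F).2 fun _ _ hx =>
    have h₀ := F.cod (G.left F.dom hx)
    have h₁ := F.cod (G.right F.dom hx)
    G.err_le h₀ (G.mono h₁ h₀ (G.err_self h₁))

theorem Good.pi_unk_mono (F : IsFam L S A B) :
    PiRel L A B (fun x => L.unk (B x)) fun x => L.unk (B x) :=
  (G.pi_mono_iff F).2 fun _ _ hx =>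
    G.unk_le_cast_unk (F.cod (G.left F.dom hx)) (F.cod (G.right F.dom hx)) (F.mono hx)

theorem Good.pi_err_le (F : IsFam L S A B) {f : ∀ x, L.El (B x)} (hf : PiRel L A B f f) :
    PiPrec L A B (fun x => L.err (B x)) f :=
  (G.pi_iff F (G.pi_err_mono F) hf).2 fun x hx => G.err_le (F.cod hx) (hf x x hx).2

theorem Good.pi_le_unk (F : IsFam L S A B) {f : ∀ x, L.El (B x)} (hf : PiRel L A B f f) :
    PiPrec L A B f fun x => L.unk (B x) :=
  (G.pi_iff F hf (G.pi_unk_mono F)).2 fun x hx => G.le_unk (F.cod hx) (hf x x hx).2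

theorem Good.pi_cast_mono (F₀ : IsFam L S A₀ B₀) (F₁ : IsFam L S A₁ B₁) {f : ∀ x, L.El (B₀ x)}
    (hf : PiRel L A₀ B₀ f f) :
    PiRel L A₁ B₁ (piCast L A₀ B₀ A₁ B₁ f) (piCast L A₀ B₀ A₁ B₁ f) := by
  refine (G.pi_mono_iff F₁).2 fun y₀ y₁ hy => ?_
  have hx := G.mono F₁.dom F₀.dom hy
  have hx₀ := G.left F₀.dom hx
  have hx₁ := G.right F₀.dom hx
  have h₀ := F₁.cod (G.left F₁.dom hy)
  have h₁ := F₁.cod (G.right F₁.dom hy)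
  have hc₀ := F₀.cod hx₀
  have hc₁ := F₀.cod hx₁
  have hf₁ := (hf _ _ hx₁).2
  -- The detour through `B₀ x₀` is removed by `lax`; the one through `B₁ y₁`, which is above the
  -- target `B₁ y₀`, is inserted by `down`.
  exact G.trans h₀ (G.mono hc₀ h₀ (hf _ _ hx).1)
    (G.trans h₀ (G.lax hc₁ hc₀ h₀ hf₁) (G.down h₀ h₁ hc₁ (F₁.mono hy) hf₁))

theorem Good.pi_mono (F₀ : IsFam L S A₀ B₀) (F₁ : IsFam L S A₁ B₁) {f g : ∀ x, L.El (B₀ x)}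
    (h : PiPrec L A₀ B₀ f g) :
    PiPrec L A₁ B₁ (piCast L A₀ B₀ A₁ B₁ f) (piCast L A₀ B₀ A₁ B₁ g) :=
  (G.pi_iff F₁ (G.pi_cast_mono F₀ F₁ h.1) (G.pi_cast_mono F₀ F₁ h.2.1)).2 fun _ hy =>
    have hx := G.mono F₁.dom F₀.dom hy
    G.mono (F₀.cod hx) (F₁.cod hy) (G.pi_apply F₀ h hx)

theorem Good.pi_cast_err (F₀ : IsFam L S A₀ B₀) (F₁ : IsFam L S A₁ B₁) :
    PiPrec L A₁ B₁ (piCast L A₀ B₀ A₁ B₁ fun x => L.err (B₀ x)) fun x => L.err (B₁ x) :=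
  (G.pi_iff F₁ (G.pi_cast_mono F₀ F₁ (G.pi_err_mono F₀)) (G.pi_err_mono F₁)).2 fun _ hy =>
    G.cast_err (F₀.cod (G.mono F₁.dom F₀.dom hy)) (F₁.cod hy)

theorem Good.pi_lax (F₀ : IsFam L S A₀ B₀) (F₁ : IsFam L S A₁ B₁) (F₂ : IsFam L S A₂ B₂)
    {f : ∀ x, L.El (B₀ x)} (hf : PiRel L A₀ B₀ f f) :
    PiPrec L A₂ B₂ (piCast L A₁ B₁ A₂ B₂ (piCast L A₀ B₀ A₁ B₁ f)) (piCast L A₀ B₀ A₂ B₂ f) := by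
  refine (G.pi_iff F₂ (G.pi_cast_mono F₁ F₂ (G.pi_cast_mono F₀ F₁ hf))
    (G.pi_cast_mono F₀ F₂ hf)).2 fun z hz => ?_
  have hx := G.lax F₂.dom F₁.dom F₀.dom hz
  have h₂ := F₂.cod hz
  have h₁ := F₁.cod (G.mono F₂.dom F₁.dom hz)
  have h₀' := F₀.cod (G.left F₀.dom hx)
  have h₀ := F₀.cod (G.right F₀.dom hx)
  exact G.trans h₂ (G.lax h₀' h₁ h₂ (hf _ _ (G.left F₀.dom hx)).2)
    (G.trans h₂ (G.mono h₀' h₂ (hf _ _ hx).1) (G.lax h₀ h₀' h₂ (hf _ _ hx).2))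

/-- By contravariance, `down` on the domains compares the two arguments given to `f`. The larger one
is the cast of `y` to `A₀`, so it is heterogeneously below `y`, and `up` applies to the codomains.
-/
theorem Good.pi_up (F₀ : IsFam L S A₀ B₀) (F₁ : IsFam L S A₁ B₁) (F₂ : IsFam L S A₂ B₂)
    (hA : L.tprec A₀ A₁) (hB : ∀ x y, L.hprec A₀ A₁ x y → L.tprec (B₀ x) (B₁ y))
    {f : ∀ x, L.El (B₀ x)} (hf : PiRel L A₀ B₀ f f) :
    PiPrec L A₂ B₂ (piCast L A₀ B₀ A₂ B₂ f) (piCast L A₁ B₁ A₂ B₂ (piCast L A₀ B₀ A₁ B₁ f)) := by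
  refine (G.pi_iff F₂ (G.pi_cast_mono F₀ F₂ hf)
    (G.pi_cast_mono F₁ F₂ (G.pi_cast_mono F₀ F₁ hf))).2 fun z hz => ?_
  have hx := G.down F₀.dom F₁.dom F₂.dom hA hz
  have hy := G.mono F₂.dom F₁.dom hz
  have h₂ := F₂.cod hz
  have h₁ := F₁.cod hy
  have hx' := G.right F₀.dom hx
  have h₀ := F₀.cod (G.left F₀.dom hx)
  have h₀' := F₀.cod hx'
  have hf' := (hf _ _ hx').2
  exact G.trans h₂ (G.mono h₀ h₂ (hf _ _ hx).1) (G.trans h₂ (G.lax h₀' h₀ h₂ hf')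
    (G.up h₀' h₁ h₂ (hB _ _ ⟨hx', hy⟩) hf'))

/-- Dual to `Good.pi_up`: `up` on the domains and `down` on the codomains. Here `x` lies below its
own upcast by `Good.unit`. -/
theorem Good.pi_down (F₀ : IsFam L S A₀ B₀) (F₁ : IsFam L S A₁ B₁) (F₂ : IsFam L S A₂ B₂)
    (hA : L.tprec A₀ A₁) (hB : ∀ x y, L.hprec A₀ A₁ x y → L.tprec (B₀ x) (B₁ y))
    {f : ∀ x, L.El (B₂ x)} (hf : PiRel L A₂ B₂ f f) :
    PiPrec L A₀ B₀ (piCast L A₂ B₂ A₀ B₀ f) (piCast L A₁ B₁ A₀ B₀ (piCast L A₂ B₂ A₁ B₁ f)) := by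
  refine (G.pi_iff F₀ (G.pi_cast_mono F₂ F₀ hf)
    (G.pi_cast_mono F₁ F₀ (G.pi_cast_mono F₂ F₁ hf))).2 fun x hx => ?_
  have hz := G.up F₀.dom F₁.dom F₂.dom hA hx
  have hy := G.mono F₀.dom F₁.dom hx
  have h₀ := F₀.cod hx
  have h₁ := F₁.cod hy
  have hz' := G.right F₂.dom hz
  have h₂ := F₂.cod (G.left F₂.dom hz)
  have h₂' := F₂.cod hz'
  have hf' := (hf _ _ hz').2
  exact G.trans h₀ (G.mono h₂ h₀ (hf _ _ hz).1) (G.trans h₀ (G.lax h₂' h₂ h₀ hf')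
    (G.down h₀ h₁ h₂' (hB _ _ ⟨G.unit F₀.dom F₁.dom hA hx, hy⟩) hf'))

theorem Good.pi_cast_id (F : IsFam L S A B) {f : ∀ x, L.El (B x)} (hf : PiRel L A B f f) :
    PiPrec L A B (piCast L A B A B f) f ∧ PiPrec L A B f (piCast L A B A B f) := by
  have hm := G.pi_cast_mono F F hf
  refine ⟨(G.pi_iff F hm hf).2 fun x hx => ?_, (G.pi_iff F hf hm).2 fun x hx => ?_⟩
  · have h := (G.cast_id F.dom hx).1
    have hB := F.cod hx
    have hB' := F.cod (G.left F.dom h)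
    exact G.trans hB (G.mono hB' hB (hf _ _ h).1) (G.cast_cast_le hB hB' (hf _ _ hx).2)
  · exact (hf _ _ (G.cast_id F.dom hx).2).1

theorem Good.pi_unk_le_cast (F₀ : IsFam L S A₀ B₀) (F₁ : IsFam L S A₁ B₁)
    (hA : L.tprec A₀ A₁) (hB : ∀ x y, L.hprec A₀ A₁ x y → L.tprec (B₀ x) (B₁ y)) :
    PiPrec L A₀ B₀ (fun x => L.unk (B₀ x)) (piCast L A₁ B₁ A₀ B₀ fun y => L.unk (B₁ y)) :=
  (G.pi_iff F₀ (G.pi_unk_mono F₀) (G.pi_cast_mono F₁ F₀ (G.pi_unk_mono F₁))).2 fun _ hx =>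
    have hy := G.mono F₀.dom F₁.dom hx
    G.unk_le_cast_unk (F₀.cod hx) (F₁.cod hy) (hB _ _ ⟨G.unit F₀.dom F₁.dom hA hx, hy⟩)

/-- Type precision on dependent products, apart from the conditions on each side. -/
theorem Good.pi_ttrans (F₀ : IsFam L S A₀ B₀) (F₁ : IsFam L S A₁ B₁) (F₂ : IsFam L S A₂ B₂)
    (hA : L.tprec A₀ A₁) (hB : ∀ x y, L.hprec A₀ A₁ x y → L.tprec (B₀ x) (B₁ y))
    (hB' : ∀ x y, L.hprec A₁ A₂ x y → L.tprec (B₁ x) (B₂ y)) {x : L.El A₀} {z : L.El A₂}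
    (h : L.hprec A₀ A₂ x z) : L.tprec (B₀ x) (B₂ z) := by
  -- The intermediate point of `A₁` is the cast of `z`; by `down` on the domains it is still above
  -- `x`.
  have hy := G.mono F₂.dom F₁.dom h.2
  have hx := G.trans F₀.dom h.1 (G.down F₀.dom F₁.dom F₂.dom hA h.2)
  exact G.ttrans (F₀.cod (G.left F₀.dom h.1)) (F₁.cod hy) (F₂.cod h.2) (hB _ _ ⟨hx, hy⟩)
    (hB' _ _ ⟨hy, h.2⟩)

end Pi

/-! ### Precision on the unknown type -/

/-- The laws of the preceding level on which a universe is built. -/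
structure LowGood (P : Option Level.{u, u}) : Prop where
  good : Good (low P) fun A => (low P).tprec A A
  tquasi : ∀ {A B}, (low P).tprec A B → (low P).tprec A A ∧ (low P).tprec B B
  uprec_trans : ∀ {A B C}, lowUprec P A B → lowUprec P B C → lowUprec P A C
  uprec_quasi : ∀ {A B}, lowUprec P A B → lowUprec P A A ∧ lowUprec P B B
  err_le : ∀ h {A}, lowUprec P A A → lowUprec P (lowErrCode P h) A
  le_unk : ∀ h {A}, lowUprec P A A → lowUprec P A (lowUnkCode P h)
  unk_self : ∀ h, lowUprec P (lowUnkCode P h) (lowUnkCode P h)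

namespace Unknown

variable {P : Option Level.{u, u}}

/-- Induction on precision derivations, through the nested lists. -/
theorem Prec.induct {motive : ∀ x y : Unknown P, Prec P x y → Prop}
    (err_refl : motive _ _ .err_refl) (unk_refl : motive _ _ .unk_refl)
    (err_min : ∀ {x y} (h : IsErr P x) (h' : Prec P y y), motive y y h' →
      motive x y (.err_min h h'))
    (unk_max : ∀ {x} (h : Prec P x x), motive x x h → motive x .unk (.unk_max h))
    (nat : ∀ {n m : XNat.{u}} (h : n.Prec m), motive _ _ (.nat h))
    (list : ∀ {l m} (h : XList.Prec (Prec P) l m),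
      XList.Prec (fun x y => ∃ h, motive x y h) l m → motive _ _ (.list h))
    (prop : ∀ h h' p q, motive _ _ (.prop h h' p q))
    (univ : ∀ {A B} (h : lowUprec P A B), motive _ _ (.univ h))
    (cum : ∀ {A B : (low P).U} {a b} (hA : (low P).tprec A A) (hB : (low P).tprec B B)
      (h : (low P).hprec A B a b), motive _ _ (.cum hA hB h))
    {x y : Unknown P} (h : Prec P x y) : motive x y h :=
  Prec.rec (motive_1 := motive)
    (motive_2 := fun l m _ => XList.Prec (fun x y => ∃ h, motive x y h) l m)
    err_refl unk_refl err_min unk_max nat list prop univ cum .err_refl .unk_refl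
    (fun _ ih => .err_min ih) (fun _ ih => .unk_max ih) .nil
    (fun h _ ih ih' => .cons ⟨h, ih⟩ ih') h



/-- What a comparison of two elements of the unknown type means, by cases on the elements. -/
def Inv : Unknown P → Unknown P → Prop
  | .nat n, .nat m => n.Prec m
  | .list l, .list m => XList.Prec (Prec P) l m
  | .prop _ _, .prop _ _ => True
  | .univ A, .univ B => lowUprec P A B
  | .cum A a, .cum B b => (low P).tprec A A ∧ (low P).tprec B B ∧ (low P).hprec A B a b
  | _, .unk => True
  | x, _ => IsErr P x

variable (LG : LowGood P)
include LG

theorem IsErr.self {x : Unknown P} (h : IsErr P x) : Prec P x x := by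
  cases h with
  | err => exact .err_refl
  | nat h => exact .nat h.quasi.1
  | list => exact .list .err_refl
  | prop h p => exact .prop h h p p
  | univ _ h => exact .univ (LG.uprec_quasi h).1
  | cum hA h =>
    have h := LG.good.left hA h
    exact .cum hA hA ⟨(LG.good.cast_id hA h).2, h⟩

theorem Prec.quasi {x y : Unknown P} (h : Prec P x y) : Prec P x x ∧ Prec P y y := by
  induction h using Prec.induct with
  | err_refl => exact ⟨.err_refl, .err_refl⟩
  | unk_refl => exact ⟨.unk_refl, .unk_refl⟩
  | err_min h h' _ => exact ⟨h.self LG, h'⟩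
  | unk_max h _ => exact ⟨h, .unk_refl⟩
  | nat h => exact ⟨.nat h.quasi.1, .nat h.quasi.2⟩
  | list _ ih =>
    have h := ih.quasi_of (r := Prec P) fun _ _ h => h.2
    exact ⟨.list h.1, .list h.2⟩
  | prop h h' p q => exact ⟨.prop _ _ _ _, .prop _ _ _ _⟩
  | univ h => exact ⟨.univ (LG.uprec_quasi h).1, .univ (LG.uprec_quasi h).2⟩
  | cum hA hB h =>
    have h₁ := LG.good.left hA h.1
    exact ⟨.cum hA hA ⟨(LG.good.cast_id hA h₁).2, h₁⟩,
      .cum hB hB ⟨(LG.good.cast_id hB h.2).2, h.2⟩⟩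

/-- Errors are downward closed, which is what transitivity needs at an error in the middle. For
pairs: a ⊑ ⟨B⇒A⟩b ⊑ ⟨B⇒A⟩err ⊑ err. -/
theorem IsErr.of_prec {x y : Unknown P} (hy : IsErr P y) (h : Prec P x y) : IsErr P x := by
  cases h with
  | err_refl => exact hy
  | unk_refl => exact hy
  | err_min h _ => exact h
  | unk_max _ => cases hy
  | nat h => cases hy with | nat h' => exact .nat (h.trans h')
  | list h =>
    cases hy
    cases h with
    | err_refl => exact .list
    | err_min => exact .list
  | prop h _ p _ => exact .prop h p
  | univ h => cases hy with | univ h₁ h' => exact .univ h₁ (LG.uprec_trans h h')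
  | cum hA hB h =>
    cases hy with
    | cum _ h' =>
      exact .cum hA (LG.good.trans hA h.1
        (LG.good.trans hA (LG.good.mono hB hA h') (LG.good.cast_err hB hA)))

theorem Prec.trans {x y z : Unknown P} (h : Prec P x y) (h' : Prec P y z) : Prec P x z := by
  have key : ∀ {x y z : Unknown P}, IsErr P y → Prec P x y → Prec P y z → Prec P x z :=
    fun hy h h' => .err_min (hy.of_prec LG h) (h'.quasi LG).2
  induction h using Prec.induct generalizing z with
  | err_refl => exact h'
  | unk_refl => exact h'
  | err_min h _ _ => exact .err_min h (h'.quasi LG).2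
  | unk_max h _ =>
    cases h' with
    | unk_refl => exact .unk_max h
    | err_min h₁ => cases h₁
    | unk_max => exact .unk_max h
  | nat h =>
    cases h' with
    | err_min h₁ h₂ => exact key h₁ (.nat h) (.err_min h₁ h₂)
    | unk_max _ => exact .unk_max (.nat h.quasi.1)
    | nat h' => exact .nat (h.trans h')
  | list h ih =>
    cases h' with
    | err_min h₁ h₂ =>
      cases h₁
      exact .err_min (by cases h <;> exact .list) h₂
    | unk_max _ => exact .unk_max ((Prec.list h).quasi LG).1
    | list h' =>
      -- Each entry of the list derivation carries its own transitivity statement.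
      exact .list (ih.trans_of (fun _ _ h => h.quasi LG)
        (fun _ _ h => ⟨h.1.quasi LG, fun _ => h.2⟩) h')
  | prop h h₀ p q =>
    cases h' with
    | err_min h₁ h₂ => exact .err_min (.prop h p) h₂
    | unk_max _ => exact .unk_max (.prop h h p p)
    | prop => exact .prop _ _ _ _
  | univ h =>
    cases h' with
    | err_min h₁ h₂ => exact key h₁ (.univ h) (.err_min h₁ h₂)
    | unk_max _ => exact .unk_max (.univ (LG.uprec_quasi h).1)
    | univ h' => exact .univ (LG.uprec_trans h h')
  | cum hA hB h =>
    cases h' with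
    | err_min h₁ h₂ => exact key h₁ (.cum hA hB h) (.err_min h₁ h₂)
    | unk_max _ => exact .unk_max ((Prec.cum hA hB h).quasi LG).1
    | cum _ hC h' =>
      exact .cum hA hC ⟨LG.good.le_cast_trans hA hB hC h'.2 h.1 h'.1, h'.2⟩

/-- The rule `err_min` overlaps with the congruence rules. Within one summand it adds nothing, since
an injected error has a payload below the error of the summand, hence below the other payload. -/
theorem Prec.inv {x y : Unknown P} (h : Prec P x y) : Inv x y := by
  induction h using Prec.induct with
  | err_refl => exact .err
  | unk_refl => trivial
  | unk_max => cases ‹Unknown P› <;> trivial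
  | nat h => exact h
  | list h _ => exact h
  | prop => trivial
  | univ h => exact h
  | cum hA hB h => exact ⟨hA, hB, h⟩
  | @err_min x y h hy ih =>
    cases h with
    | err => cases y <;> first | exact .err | trivial
    | nat h => cases y <;> first | exact .nat h | trivial | exact h.trans (.err_min ih)
    | list => cases y <;> first | exact .list | trivial | exact .err_min ih
    | prop h p => cases y <;> first | trivial | exact .prop h p
    | univ h h' =>
      cases y <;> first
        | exact LG.uprec_trans h' (LG.err_le h ih) | exact .univ h h' | trivial
    | cum h h' =>
      cases y <;> first
        | exact ⟨h, ih.1, LG.good.trans h h' (LG.good.err_le h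
            (LG.good.mono ih.1 h ih.2.2.2)), ih.2.2.2⟩
        | exact .cum h h' | trivial

end Unknown

open Unknown (IsErr)

variable {P : Option Level.{u, u}}

/-! ### Codes and their casts -/

namespace Code

/-- The code together with the type it decodes to. -/
abbrev bundle {X : Type u} (c : Code P X) : (next P).U := ⟨X, c⟩

/-- The casts between two codes do not fail for the reason that the head constructors differ. -/
def Compat : {X : Type u} → Code P X → {Y : Type u} → Code P Y → Prop
  | _, .unk, _, _ => True
  | _, _, _, .unk => True
  | _, .nat, _, .nat => True
  | _, .list _, _, .list _ => True
  | _, .pi _ _, _, .pi _ _ => True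
  | _, .prop _, _, .prop _ => True
  | _, .univ _, _, .univ _ => True
  | _, .cum _, _, .cum _ => True
  | _, _, _, _ => False

variable {X Y Z : Type u}

theorem cast_of_not_compat {c : Code P X} {d : Code P Y} (h : ¬ c.Compat d) (x : X) :
    c.cast d x = d.errOf := by
  cases c <;> cases d <;> first | rfl | exact absurd trivial h

theorem ofUnk_toUnk_of_not_compat {c : Code P X} {d : Code P Y} (h : ¬ c.Compat d) (x : X) :
    d.ofUnk (c.toUnk x) = d.errOf := by
  cases c <;> cases d <;> first | rfl | exact absurd trivial h

theorem cast_unk (c : Code P X) : c.cast .unk = c.toUnk := by cases c <;> rfl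

theorem ofUnk_unk (c : Code P X) : c.ofUnk .unk = c.unkOf := by cases c <;> rfl

/-- The domain cast inside a cast of products is the second component of a pair computed in the
other direction; this identifies it with an ordinary cast. -/
theorem castPair_swap (c : Code P X) (d : Code P Y) :
    c.castPair d = ((d.castPair c).2, (d.castPair c).1) := by
  induction c generalizing Y with
  | list c ih =>
    cases d with
    | list d =>
      have h := ih d
      exact Prod.ext (congrArg XList.map (congrArg Prod.fst h))
        (congrArg XList.map (congrArg Prod.snd h))
    | _ => rfl
  | pi c c' ih ih' =>
    cases d with
    | pi d d' =>
      have h := ih d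
      refine Prod.ext ?_ ?_
      · funext f y
        change ((c' ((c.castPair d).2 y)).castPair (d' y)).1 (f ((c.castPair d).2 y)) =
          ((d' y).castPair (c' ((d.castPair c).1 y))).2 (f ((d.castPair c).1 y))
        rw [h, ih']
      · funext g x
        change ((c' x).castPair (d' ((c.castPair d).1 x))).2 (g ((c.castPair d).1 x)) =
          ((d' ((d.castPair c).2 x)).castPair (c' x)).1 (g ((d.castPair c).2 x))
        rw [h, ih']
    | _ => rfl
  | _ => cases d <;> rfl

/-- Brings casts of product codes into the form treated by the abstract `Good.pi_*` lemmas. -/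
theorem cast_pi {Y : X → Type u} {X' : Type u} {Y' : X' → Type u} (c : Code P X)
    (d : ∀ x, Code P (Y x)) (c' : Code P X') (d' : ∀ x, Code P (Y' x)) (f : ∀ x, Y x) :
    (Code.pi c d).cast (Code.pi c' d') f =
      piCast (next P).toPreLevel c.bundle (fun x => (d x).bundle) c'.bundle
        (fun x => (d' x).bundle) f := by
  have h : (c.castPair c').2 = (c'.castPair c).1 := congrArg Prod.snd (castPair_swap c c')
  funext y
  change (((d ((c.castPair c').2 y)).castPair (d' y)).1 (f ((c.castPair c').2 y))) = _
  rw [h]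
  rfl

/-- What a comparison of two codes means, by cases on the codes. -/
def TInv : {X : Type u} → Code P X → {Y : Type u} → Code P Y → Prop
  | _, .err, _, d => TPrec d d
  | _, .nat, _, .nat => True
  | _, .nat, _, .unk => True
  | _, .list c, _, .list d => TPrec c d
  | _, .list c, _, .unk => TPrec c (.unk : Code P _)
  | _, .pi c d, _, .pi c' d' =>
    TPrec c c' ∧ (∀ x₀ x₁, c.prec x₀ x₁ → TPrec (d x₀) (d x₁)) ∧
    (∀ x₀ x₁, c'.prec x₀ x₁ → TPrec (d' x₀) (d' x₁)) ∧
    ∀ x x', c.hprec c' x x' → TPrec (d x) (d' x')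
  | _, .unk, _, .unk => True
  | _, .prop _, _, .prop _ => True
  | _, .prop _, _, .unk => True
  | _, .box _ _, _, .box _ _ => True
  | _, .univ _, _, .univ _ => True
  | _, .univ _, _, .unk => True
  | _, .cum A, _, .cum B => (low P).tprec A B
  | _, .cum A, _, .unk => (low P).tprec A A
  | _, _, _, _ => False

/-- Between two constructor forms, case analysis on a derivation would meet equations such as `XList
X = XList Y` between types. With general codes it succeeds, and `TInv` then computes to the wanted
premises. -/
theorem TPrec.inv {c : Code P X} {d : Code P Y} (h : TPrec c d) : TInv c d := by
  cases h with
  | list h => exact h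
  | list_unk h => exact h
  | pi h₁ h₂ h₃ h₄ => exact ⟨h₁, h₂, h₃, h₄⟩
  | err_min h => exact h
  | err_refl => exact .err_refl
  | cum h => exact h
  | cum_unk h => exact h
  | _ => trivial

/-- The immediate subcodes are in the class `S`. -/
def SubMem (S : (next P).U → Prop) : {X : Type u} → Code P X → Prop
  | _, .list c => S c.bundle ∧ S (bundle .unk)
  | _, .pi c d => IsFam (next P).toPreLevel S c.bundle fun x => (d x).bundle
  | _, .cum A => (low P).tprec A A
  | _, _ => True

variable {S : (next P).U → Prop} (LG : LowGood P)
  (G : Good (next P).toPreLevel S) {c : Code P X} {d : Code P Y} {e : Code P Z}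
include LG G

/-! ### The laws for one type -/

theorem SubMem.quasi (hc : c.SubMem S) {a b : X} (h : c.prec a b) : c.prec a a ∧ c.prec b b := by
  cases c with
  | nat => exact XNat.Prec.quasi h
  | list c => exact XList.Prec.quasi_of (fun _ _ => G.quasi hc.1) h
  | pi c d => exact ⟨⟨h.1, h.1, h.1⟩, ⟨h.2.1, h.2.1, h.2.1⟩⟩
  | unk => exact Unknown.Prec.quasi LG h
  | univ => exact LG.uprec_quasi h
  | cum A => exact LG.good.quasi hc h
  | _ => exact ⟨trivial, trivial⟩

theorem SubMem.trans (hc : c.SubMem S) {x y z : X} (h : c.prec x y) (h' : c.prec y z) :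
    c.prec x z := by
  cases c with
  | nat => exact XNat.Prec.trans h h'
  | list c =>
    exact XList.Prec.trans_of (q := c.prec) (r := c.prec) (fun _ _ => G.quasi hc.1)
      (fun _ _ h => ⟨G.quasi hc.1 h, fun _ => G.trans hc.1 h⟩) h h'
  | pi c d => exact G.pi_trans hc h h'
  | unk => exact Unknown.Prec.trans LG h h'
  | univ => exact LG.uprec_trans h h'
  | cum A => exact LG.good.trans hc h h'
  | _ => trivial

theorem SubMem.err_le (hc : c.SubMem S) {x : X} (h : c.prec x x) : c.prec c.errOf x := by
  cases c with
  | nat => exact XNat.Prec.err_min h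
  | list c => exact XList.Prec.err_min h
  | pi c d => exact G.pi_err_le hc h.1
  | unk => exact .err_min .err h
  | univ => exact LG.err_le _ h
  | cum A => exact LG.good.err_le hc h
  | _ => trivial

theorem SubMem.le_unk (hc : c.SubMem S) {x : X} (h : c.prec x x) : c.prec x c.unkOf := by
  cases c with
  | nat => exact XNat.Prec.unk_max h
  | list c => exact XList.Prec.unk_max h
  | pi c d => exact G.pi_le_unk hc h.1
  | unk => exact .unk_max h
  | univ => exact LG.le_unk _ h
  | cum A => exact LG.good.le_unk hc h
  | _ => trivial

theorem SubMem.unk_self (hc : c.SubMem S) : c.prec c.unkOf c.unkOf := by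
  cases c with
  | nat => exact XNat.Prec.unk_refl
  | list c => exact XList.Prec.unk_refl
  | pi c d =>
    have h := G.pi_unk_mono hc
    exact ⟨h, h, h⟩
  | unk => exact .unk_refl
  | univ => exact LG.unk_self _
  | cum A => exact LG.good.unk_self hc
  | _ => trivial

theorem SubMem.err_self (hc : c.SubMem S) : c.prec c.errOf c.errOf :=
  (hc.quasi LG G (hc.err_le LG G (hc.unk_self LG G))).1

/-! ### Casts to and from the unknown type -/

theorem SubMem.isErr_toUnk_err (hc : c.SubMem S) : IsErr P (c.toUnk c.errOf) := by
  cases c with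
  | nat => exact .nat .err_refl
  | list => exact .list
  | prop h => exact .prop h _
  | univ h => exact .univ h (SubMem.err_self LG G hc)
  | cum A => exact .cum hc (LG.good.err_self hc)
  | _ => exact .err

theorem SubMem.toUnk_mono (hc : c.SubMem S) {x y : X} (h : c.prec x y) :
    Unknown.Prec P (c.toUnk x) (c.toUnk y) := by
  cases c with
  | nat => exact .nat h
  | list c =>
    refine .list (XList.Prec.map (r := c.prec) (s := Unknown.Prec P)
      (fun _ _ => Unknown.Prec.quasi LG) (fun x y h => ?_) h)
    rw [← cast_unk]
    exact G.mono (A := c.bundle) (B := bundle .unk) hc.1 hc.2 h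
  | unk => exact h
  | prop h => exact .prop _ _ _ _
  | univ => exact .univ h
  | cum A =>
    exact .cum hc hc ⟨LG.good.trans hc h (LG.good.cast_id hc (LG.good.right hc h)).2,
      LG.good.right hc h⟩
  | _ => exact .err_refl

theorem SubMem.ofUnk_le_err (hc : c.SubMem S) {x : Unknown P} (h : IsErr P x) :
    c.prec (c.ofUnk x) c.errOf := by
  have h₀ := hc.err_self LG G
  cases c <;> cases h <;> first
    | exact h₀
    | (rename_i h; exact h)
    | trivial
    | exact XList.Prec.err_refl
    | exact Unknown.Prec.err_min (by constructor <;> assumption) .err_refl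
    | skip
  -- What remains is a pair `(B, b)` with `b` below the error of `B`, cast to `A`.
  rename_i A B b h h'
  exact LG.good.trans hc (LG.good.mono h hc h') (LG.good.cast_err h hc)

theorem SubMem.ofUnk_self (hc : c.SubMem S) {x : Unknown P} (h : Unknown.Prec P x x) :
    c.prec (c.ofUnk x) (c.ofUnk x) := by
  have h₀ := hc.err_self LG G
  have h₁ := hc.unk_self LG G
  have h' := h.inv LG
  cases c <;> cases x <;> first | exact h₀ | exact h₁ | exact h | exact h' | skip
  · exact XList.Prec.map_self (fun x h => G.mono (A := bundle .unk) (B := bundle _) hc.2 hc.1 h) h'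
  · exact LG.good.mono h'.1 hc h'.2.2.2

theorem SubMem.ofUnk_mono (hc : c.SubMem S) {x y : Unknown P} (h : Unknown.Prec P x y) :
    c.prec (c.ofUnk x) (c.ofUnk y) := by
  have h₀ := hc.err_self LG G
  cases h with
  | err_refl => exact hc.ofUnk_self LG G .err_refl
  | unk_refl => exact hc.ofUnk_self LG G .unk_refl
  | err_min h h' =>
    -- The error of the target separates the two images.
    exact hc.trans LG G (hc.ofUnk_le_err LG G h) (hc.err_le LG G (hc.ofUnk_self LG G h'))
  | unk_max h =>
    rw [ofUnk_unk]
    exact hc.le_unk LG G (hc.ofUnk_self LG G h)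
  | nat h => cases c <;> first | exact h₀ | exact h | exact .nat h
  | list h =>
    cases c <;> first | exact h₀ | exact .list h | skip
    rename_i c
    exact XList.Prec.map (r := Unknown.Prec P) (s := c.prec) (fun _ _ => G.quasi hc.1)
      (fun x y h => G.mono (A := bundle .unk) (B := bundle _) hc.2 hc.1 h) h
  | prop h h' p q => cases c <;> first | exact h₀ | exact .prop _ _ _ _
  | univ h => cases c <;> first | exact h₀ | exact h | exact .univ h
  | cum hA hB h =>
    cases c <;> first | exact h₀ | exact .cum hA hB h | skip
    -- The types of the two pairs need not be related, so this requires `lax` for arbitrary types.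
    exact LG.good.trans hc (LG.good.mono hA hc h.1) (LG.good.lax hB hA hc h.2)

theorem SubMem.toUnk_ofUnk_le (hc : c.SubMem S) {x : Unknown P} (h : Unknown.Prec P x x) :
    Unknown.Prec P (c.toUnk (c.ofUnk x)) x := by
  have h₀ := Unknown.Prec.err_min (hc.isErr_toUnk_err LG G) h
  have h' := h.inv LG
  cases x with
  | unk => exact .unk_max (hc.toUnk_mono LG G (hc.ofUnk_self LG G h))
  | err => cases c <;> exact h₀
  | nat => cases c <;> first | exact h₀ | exact h
  | prop => cases c <;> first | exact h₀ | exact h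
  | univ => cases c <;> first | exact h₀ | exact h
  | list l =>
    cases c <;> first | exact h₀ | exact h | skip
    rename_i c
    change Unknown.Prec P (.list ((l.map c.ofUnk).map c.toUnk)) _
    rw [XList.map_map]
    conv => rhs; rw [← XList.map_id l]
    refine .list (XList.Prec.map_self (fun x h => ?_) h')
    rw [← cast_unk]
    exact G.cast_cast_le (A := bundle .unk) (B := c.bundle) hc.2 hc.1 h
  | cum A a =>
    cases c <;> first | exact h₀ | exact h | skip
    have ha := LG.good.mono h'.1 hc h'.2.2.2
    -- A pair whose element has been cast to another type is below the original pair: the comparison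
    -- happens in the new type, where both sides are the same cast.
    exact .cum hc h'.1 ⟨ha, h'.2.2.2⟩

/-! ### The laws for casts -/

theorem SubMem.cast_mono (hc : c.SubMem S) (hd : d.SubMem S) {x y : X} (h : c.prec x y) :
    d.prec (c.cast d x) (c.cast d y) := by
  by_cases hcd : c.Compat d
  · cases d with
    | unk =>
      rw [cast_unk]
      exact hc.toUnk_mono LG G h
    | nat =>
      cases c <;> first | exact False.elim hcd | exact h | exact hd.ofUnk_mono LG G h
    | list d =>
      cases c <;> first | exact False.elim hcd | exact hd.ofUnk_mono LG G h | skip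
      rename_i c
      exact XList.Prec.map (r := c.prec) (s := d.prec) (fun _ _ => G.quasi hd.1)
        (fun x y h => G.mono (A := c.bundle) (B := d.bundle) hc.1 hd.1 h) h
    | pi d d' =>
      cases c <;> first | exact False.elim hcd | exact hd.ofUnk_mono LG G h | skip
      rw [cast_pi, cast_pi]
      exact G.pi_mono hc hd h
    | univ =>
      cases c <;> first | exact False.elim hcd | exact h | exact hd.ofUnk_mono LG G h
    | cum A =>
      cases c <;> first
        | exact False.elim hcd | exact LG.good.mono hc hd h | exact hd.ofUnk_mono LG G h
    | _ => trivial
  · rw [cast_of_not_compat hcd, cast_of_not_compat hcd]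
    exact hd.err_self LG G

theorem SubMem.cast_err (hc : c.SubMem S) (hd : d.SubMem S) :
    d.prec (c.cast d c.errOf) d.errOf := by
  have h₀ := hd.err_self LG G
  by_cases hcd : c.Compat d
  · cases d with
    | unk =>
      rw [cast_unk]
      exact .err_min (hc.isErr_toUnk_err LG G) .err_refl
    | pi d d' =>
      cases c <;> first | exact False.elim hcd | exact h₀ | skip
      rw [cast_pi]
      exact G.pi_cast_err hc hd
    | cum A => cases c <;> first | exact False.elim hcd | exact h₀ | exact LG.good.cast_err hc hd
    | _ => cases c <;> first | exact False.elim hcd | exact h₀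
  · rw [cast_of_not_compat hcd]
    exact h₀

theorem SubMem.cast_id (hc : c.SubMem S) {x : X} (h : c.prec x x) :
    c.prec (c.cast c x) x ∧ c.prec x (c.cast c x) := by
  cases c with
  | nat => exact ⟨h, h⟩
  | unk => exact ⟨h, h⟩
  | univ => exact ⟨h, h⟩
  | list c =>
    change XList.Prec _ (XList.map _ _) _ ∧ XList.Prec _ _ (XList.map _ _)
    conv => lhs; rhs; rw [← XList.map_id x]
    conv => rhs; lhs; rw [← XList.map_id x]
    exact ⟨XList.Prec.map_self (fun x h => (G.cast_id hc.1 h).1) h,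
      XList.Prec.map_self (fun x h => (G.cast_id hc.1 h).2) h⟩
  | pi c d =>
    rw [cast_pi]
    exact G.pi_cast_id hc h.1
  | cum A => exact LG.good.cast_id hc h
  | _ => exact ⟨trivial, trivial⟩

/-- Through ?, a cast between products collapses to the error, lists recurse on their elements, and
the other compatible casts agree with the direct one. -/
theorem SubMem.lax_unk (hc : c.SubMem S) (hd : d.SubMem S) {x : X} (h : c.prec x x) :
    d.prec (d.ofUnk (c.toUnk x)) (c.cast d x) := by
  by_cases hcd : c.Compat d
  · have h₁ := hc.cast_mono LG G hd h
    have h₀ := hd.err_le LG G h₁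
    cases d with
    | unk => cases c <;> exact h₁
    | list d =>
      cases c <;> first | exact False.elim hcd | exact h₁ | skip
      rename_i c
      change XList.Prec d.prec ((x.map c.toUnk).map d.ofUnk) (x.map (c.cast d))
      rw [XList.map_map]
      refine XList.Prec.map_self (fun x h => ?_) h
      rw [← cast_unk]
      exact G.lax (A := c.bundle) (B := bundle .unk) (C := d.bundle) hc.1 hc.2 hd.1 h
    | _ => cases c <;> first | exact False.elim hcd | exact h₁ | exact h₀
  · rw [ofUnk_toUnk_of_not_compat hcd, cast_of_not_compat hcd]
    exact hd.err_self LG G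

/-- If either of the two successive casts fails, the composite is below the error of `e`, which is
least. Otherwise the head of the middle code nearly determines the other two, each having that head
or being ?. -/
theorem SubMem.lax (hc : c.SubMem S) (hd : d.SubMem S) (he : e.SubMem S) {x : X}
    (h : c.prec x x) : e.prec (d.cast e (c.cast d x)) (c.cast e x) := by
  have h₁ := hc.cast_mono LG G he h
  have h₀ := he.err_le LG G h₁
  by_cases hcd : c.Compat d
  swap
  · rw [cast_of_not_compat hcd]
    exact he.trans LG G (hd.cast_err LG G he) h₀
  by_cases hde : d.Compat e
  swap
  · rw [cast_of_not_compat hde]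
    exact h₀
  cases d with
  | unk =>
    rw [cast_unk]
    exact hc.lax_unk LG G he h
  | nat =>
    cases c <;> first | exact False.elim hcd | skip
    · exact h₁
    · cases e <;> first | exact False.elim hde | exact h₁ | exact hd.toUnk_ofUnk_le LG G h
  | prop =>
    cases c <;> first | exact False.elim hcd | skip
    · cases e <;> first | exact False.elim hde | exact h₁ | exact hd.toUnk_ofUnk_le LG G h
    · exact h₁
  | univ =>
    cases c <;> first | exact False.elim hcd | skip
    · cases e <;> first | exact False.elim hde | exact h₁ | exact hd.toUnk_ofUnk_le LG G h
    · exact h₁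
  | list d =>
    cases c <;> first | exact False.elim hcd | skip
    · rename_i c
      cases e <;> first | exact False.elim hde | skip
      · rename_i e
        change XList.Prec e.prec ((x.map (c.cast d)).map (d.cast e)) (x.map (c.cast e))
        rw [XList.map_map]
        exact XList.Prec.map_self (fun x h =>
          G.lax (A := c.bundle) (B := d.bundle) (C := e.bundle) hc.1 hd.1 he.1 h) h
      · change Unknown.Prec P (.list ((x.map (c.cast d)).map d.toUnk)) (.list (x.map c.toUnk))
        rw [XList.map_map]
        refine .list (XList.Prec.map_self (fun x h => ?_) h)
        rw [← cast_unk, ← cast_unk]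
        exact G.lax (A := c.bundle) (B := d.bundle) (C := bundle .unk) hc.1 hd.1 hc.2 h
    · cases e <;> first | exact False.elim hde | exact hd.toUnk_ofUnk_le LG G h | skip
      rename_i e
      have h' := h.inv LG
      cases x <;> first | exact h₁ | skip
      rename_i l
      change XList.Prec e.prec ((l.map d.ofUnk).map (d.cast e)) (l.map e.ofUnk)
      rw [XList.map_map]
      exact XList.Prec.map_self (fun x h =>
        G.lax (A := bundle .unk) (B := d.bundle) (C := e.bundle) hd.2 hd.1 he.1 h) h'
  | pi d d' =>
    cases c <;> first | exact False.elim hcd | skip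
    · cases e <;> first | exact False.elim hde | exact h₁ | skip
      rw [cast_pi, cast_pi, cast_pi]
      exact G.pi_lax hc hd he h.1
    · cases e <;> first | exact False.elim hde | exact hd.toUnk_ofUnk_le LG G h | skip
      -- Every element of ? other than the unknown term reaches the product as its error; the
      -- unknown term is sent by the direct cast to the unknown term of `e`, which is greatest.
      cases x <;> first
        | exact hd.cast_err LG G he
        | exact he.le_unk LG G (hd.cast_mono LG G he (hd.unk_self LG G))
  | cum B =>
    cases c <;> first | exact False.elim hcd | skip
    · cases e <;> first | exact False.elim hde | exact hd.toUnk_ofUnk_le LG G h | skip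
      have h' := h.inv LG
      cases x <;> first
        | exact LG.good.lax h'.1 hd he h'.2.2.2
        | exact hd.cast_err LG G he
        | exact he.le_unk LG G (hd.cast_mono LG G he (hd.unk_self LG G))
    · cases e <;> first | exact False.elim hde | exact LG.good.lax hc hd he h | skip
      exact .cum hd hc ⟨LG.good.mono hc hd h, h⟩
  | err =>
    cases c <;> first | exact False.elim hcd | skip
    cases e <;> first | exact False.elim hde | exact .err_min .err h
  | box =>
    cases c <;> first | exact False.elim hcd | skip
    cases e <;> first | exact False.elim hde | exact hd.toUnk_ofUnk_le LG G h

theorem SubMem.up (hc : c.SubMem S) (hd : d.SubMem S) (he : e.SubMem S) (hcd : TPrec c d) {x : X}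
    (h : c.prec x x) : e.prec (c.cast e x) (d.cast e (c.cast d x)) := by
  have hx := hc.cast_mono LG G hd h
  have h₁ := hc.cast_mono LG G he h
  have h₂ := he.err_le LG G (hd.cast_mono LG G he hx)
  by_cases hce : c.Compat e
  swap
  · rw [cast_of_not_compat hce]
    exact h₂
  cases hcd with
  | nat => exact h₁
  | prop => exact h₁
  | univ => exact h₁
  | unk_refl => exact h₁
  | nat_unk => cases e <;> first | exact False.elim hce | exact h₁
  | prop_unk => cases e <;> first | exact False.elim hce | exact h₁
  | univ_unk => cases e <;> first | exact False.elim hce | exact h₁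
  | cum_unk => cases e <;> first | exact False.elim hce | exact h₁
  | err_refl => cases e <;> first | exact False.elim hce | exact h₂
  | err_min => cases e <;> first | exact False.elim hce | exact h₂
  | box => cases e <;> first | exact False.elim hce | exact h₂
  | @list X Y c d hcd =>
    cases e <;> first | exact False.elim hce | skip
    · rename_i e
      change XList.Prec e.prec (x.map (c.cast e)) ((x.map (c.cast d)).map (d.cast e))
      rw [XList.map_map]
      exact XList.Prec.map_self (fun x h =>
        G.up (A := c.bundle) (B := d.bundle) (C := e.bundle) hc.1 hd.1 he.1 hcd h) h
    · change Unknown.Prec P (.list (x.map c.toUnk)) (.list ((x.map (c.cast d)).map d.toUnk))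
      rw [XList.map_map]
      refine .list (XList.Prec.map_self (fun x h => ?_) h)
      rw [← cast_unk, ← cast_unk]
      exact G.up (A := c.bundle) (B := d.bundle) (C := bundle .unk) hc.1 hd.1 hc.2 hcd h
  | @list_unk X c hcd =>
    cases e <;> first | exact False.elim hce | exact h₁ | skip
    rename_i e
    change XList.Prec e.prec (x.map (c.cast e)) ((x.map c.toUnk).map e.ofUnk)
    rw [XList.map_map]
    refine XList.Prec.map_self (fun x h => ?_) h
    rw [← cast_unk]
    exact G.up (A := c.bundle) (B := bundle .unk) (C := e.bundle) hc.1 hc.2 he.1 hcd h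
  | pi hA _ _ hB =>
    cases e <;> first | exact False.elim hce | exact h₂ | skip
    rw [cast_pi, cast_pi, cast_pi]
    exact G.pi_up hc hd he hA hB h.1
  | cum hcd =>
    cases e <;> first | exact False.elim hce | exact LG.good.up hc hd he hcd h | skip
    -- With target ?, the claim is that a pair is below the pair of its upcast, which is the unit of
    -- the adjunction.
    exact .cum hc hd ⟨LG.good.unit hc hd hcd h, hx⟩

theorem SubMem.down (hc : c.SubMem S) (hd : d.SubMem S) (he : e.SubMem S) (hcd : TPrec c d)
    {x : Z} (h : e.prec x x) : c.prec (e.cast c x) (d.cast c (e.cast d x)) := by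
  have h₁ := he.cast_mono LG G hc h
  have h₂ := hc.err_le LG G (hd.cast_mono LG G hc (he.cast_mono LG G hd h))
  by_cases hec : e.Compat c
  swap
  · rw [cast_of_not_compat hec]
    exact h₂
  cases hcd with
  | nat => exact h₁
  | prop => trivial
  | univ => exact h₁
  | unk_refl =>
    rw [cast_unk] at h₁ ⊢
    exact h₁
  | nat_unk => cases e <;> first | exact False.elim hec | exact h₁
  | prop_unk => trivial
  | univ_unk => cases e <;> first | exact False.elim hec | exact h₁
  | cum_unk => cases e <;> first | exact False.elim hec | exact h₁
  | err_refl => trivial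
  | err_min => trivial
  | box => trivial
  | @list X Y c d hcd =>
    cases e <;> first | exact False.elim hec | skip
    · rename_i e
      change XList.Prec c.prec (x.map (e.cast c)) ((x.map (e.cast d)).map (d.cast c))
      rw [XList.map_map]
      exact XList.Prec.map_self (fun x h =>
        G.down (A := c.bundle) (B := d.bundle) (C := e.bundle) hc.1 hd.1 he.1 hcd h) h
    · have h' := h.inv LG
      cases x <;> first | exact h₁ | skip
      rename_i l
      change XList.Prec c.prec (l.map c.ofUnk) ((l.map d.ofUnk).map (d.cast c))
      rw [XList.map_map]
      exact XList.Prec.map_self (fun x h =>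
        G.down (A := c.bundle) (B := d.bundle) (C := bundle .unk) hc.1 hd.1 hc.2 hcd h) h'
  | @list_unk X c hcd =>
    cases e <;> first | exact False.elim hec | exact h₁ | skip
    rename_i e
    change XList.Prec c.prec (x.map (e.cast c)) ((x.map e.toUnk).map c.ofUnk)
    rw [XList.map_map]
    refine XList.Prec.map_self (fun x h => ?_) h
    rw [← cast_unk]
    exact G.down (A := c.bundle) (B := bundle .unk) (C := e.bundle) hc.1 hc.2 he.1 hcd h
  | pi hA _ _ hB =>
    cases e <;> first | exact False.elim hec | skip
    · rw [cast_pi, cast_pi, cast_pi]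
      exact G.pi_down hc hd he hA hB h.1
    -- From ?, only the unknown term reaches a product without failing, as the pointwise unknown
    -- function.
    · rw [cast_pi] at h₂ ⊢
      cases x <;> first | exact h₂ | exact G.pi_unk_le_cast hc hd hA hB
  | cum hcd =>
    cases e <;> first | exact False.elim hec | exact LG.good.down hc hd he hcd h | skip
    have h' := h.inv LG
    cases x <;> first
      | exact h₂
      | exact LG.good.unk_le_cast_unk hc hd hcd
      | exact LG.good.down hc hd h'.1 hcd h'.2.2.2

/-! ### Transitivity of type precision, and the passage from subcodes to codes -/

theorem SubMem.ttrans (hc : c.SubMem S) (hd : d.SubMem S) (he : e.SubMem S) (hcd : TPrec c d)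
    (hde : TPrec d e) (hee : TPrec e e) : TPrec c e := by
  cases hcd with
  | nat => exact hde
  | prop => exact hde
  | univ => exact hde
  | unk_refl => exact hde
  | err_refl => exact hde
  -- The error type is only below self-precise types, and quasi-reflexivity is not yet available to
  -- derive this from `hde`.
  | err_min => exact .err_min hee
  | nat_unk => cases e <;> first | exact .nat_unk | exact False.elim hde.inv
  | prop_unk => cases e <;> first | exact .prop_unk _ | exact False.elim hde.inv
  | univ_unk => cases e <;> first | exact .univ_unk _ | exact False.elim hde.inv
  | cum_unk h => cases e <;> first | exact .cum_unk h | exact False.elim hde.inv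
  | list_unk h => cases e <;> first | exact .list_unk h | exact False.elim hde.inv
  | box h p q => cases e <;> first | exact .box h p _ | exact False.elim hde.inv
  | cum hcd =>
    cases e <;> first | exact False.elim hde.inv | skip
    · exact .cum_unk hc
    · exact .cum (LG.good.ttrans hc hd he hcd hde.inv)
  | @list X Y c d hcd =>
    cases e <;> first | exact False.elim hde.inv | skip
    · rename_i e
      exact .list (G.ttrans (A := c.bundle) (B := d.bundle) (C := e.bundle)
        hc.1 hd.1 he.1 hcd hde.inv)
    · exact .list_unk (G.ttrans (A := c.bundle) (B := d.bundle) (C := bundle .unk)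
        hc.1 hd.1 hc.2 hcd hde.inv)
  | pi hA hB _ hAB =>
    cases e <;> first | exact False.elim hde.inv | skip
    obtain ⟨hA', -, hB', hAB'⟩ := hde.inv
    exact .pi (G.ttrans hc.dom hd.dom he.dom hA hA') hB hB'
      fun _ _ h => G.pi_ttrans hc hd he hA hAB hAB' h

/-- The laws pass from the immediate subcodes to codes. -/
theorem good_subMem :
    Good (next P).toPreLevel fun A => A.2.TPrec A.2 ∧ A.2.SubMem S where
  tself hA := hA.1
  ttrans hA hB hC := fun h h' => hA.2.ttrans LG G hB.2 hC.2 h h' hC.1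
  trans hA := fun h h' => hA.2.trans LG G h h'
  quasi hA := fun h => hA.2.quasi LG G h
  err_le hA := fun h => hA.2.err_le LG G h
  le_unk hA := fun h => hA.2.le_unk LG G h
  unk_self hA := hA.2.unk_self LG G
  mono hA hB := fun h => hA.2.cast_mono LG G hB.2 h
  cast_err hA hB := hA.2.cast_err LG G hB.2
  lax hA hB hC := fun h => hA.2.lax LG G hB.2 hC.2 h
  up hA hB hC := fun h _ h' => hA.2.up LG G hB.2 hC.2 h h'
  down hA hB hC := fun h _ h' => hA.2.down LG G hB.2 hC.2 h h'
  cast_id hA := fun h => hA.2.cast_id LG G h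

end Code

/-! ### Induction on the rank of codes -/

/-- The rank of a code. -/
noncomputable def Code.rank : {X : Type u} → Code P X → Ordinal.{u}
  | _, .list c => Order.succ c.rank
  | _, .pi c d => max (Order.succ c.rank) (⨆ x, Order.succ (d x).rank)
  | _, _ => 0

/-- The self-precise types of rank less than `α`. -/
def SelfBelow (P : Option Level.{u, u}) (α : Ordinal.{u}) (A : (next P).U) : Prop :=
  A.2.TPrec A.2 ∧ A.2.rank < α

/-- Subcodes have strictly smaller rank. A list code also needs ? in the class; ? has rank 0, and
`α` is positive because it exceeds the rank of the element code. -/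
theorem Code.SubMem.of_rank_le {α : Ordinal.{u}} {X : Type u} {c : Code P X} (hc : c.TPrec c)
    (h : c.rank ≤ α) : c.SubMem (SelfBelow P α) := by
  cases c with
  | list c =>
    have h := Order.succ_le_iff.1 h
    exact ⟨⟨hc.inv, h⟩, .unk_refl, (zero_le (a := c.rank)).trans_lt h⟩
  | pi c d =>
    obtain ⟨h₁, h₂⟩ := max_le_iff.1 h
    have hS : SelfBelow P α c.bundle := ⟨hc.inv.1, Order.succ_le_iff.1 h₁⟩
    exact ⟨hS, fun {x} hx => ⟨hc.inv.2.1 _ _ hx,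
      Order.succ_le_iff.1 ((Ordinal.le_iSup _ x).trans h₂)⟩, fun hx => hc.inv.2.1 _ _ hx⟩
  | cum A => exact hc.inv
  | _ => trivial

theorem good_selfBelow (LG : LowGood P) (α : Ordinal.{u}) :
    Good (next P).toPreLevel (SelfBelow P α) := by
  induction α using WellFoundedLT.induction with
  | ind α ih =>
    refine Good.of_directed fun A B C hA hB hC => ?_
    -- A law involves at most three types. The immediate subcodes of all three have rank below this
    -- maximum, which is itself below `α`.
    have G := ih (max A.2.rank (max B.2.rank C.2.rank)) (max_lt hA.2 (max_lt hB.2 hC.2))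
    exact ⟨_, Code.good_subMem LG G, ⟨hA.1, .of_rank_le hA.1 (by simp)⟩,
      ⟨hB.1, .of_rank_le hB.1 (by simp)⟩, ⟨hC.1, .of_rank_le hC.1 (by simp)⟩⟩

theorem good_next (LG : LowGood P) :
    Good (next P).toPreLevel fun A => (next P).tprec A A :=
  Good.of_directed fun A B C hA hB hC =>
    ⟨_, good_selfBelow LG (Order.succ (max A.2.rank (max B.2.rank C.2.rank))),
      ⟨hA, by simp⟩, ⟨hB, by simp⟩, ⟨hC, by simp⟩⟩

theorem Code.TPrec.quasi (LG : LowGood P) {X Y : Type u} {c : Code P X} {d : Code P Y}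
    (h : TPrec c d) : TPrec c c ∧ TPrec d d := by
  have G := good_next LG
  induction h with
  | nat => exact ⟨.nat, .nat⟩
  | nat_unk => exact ⟨.nat, .unk_refl⟩
  | list _ ih => exact ⟨.list ih.1, .list ih.2⟩
  | list_unk _ ih => exact ⟨.list ih.1, .unk_refl⟩
  | @pi X _ X' _ c d c' d' _ hB hB' _ ih =>
    -- Heterogeneous precision of a type with itself reduces to homogeneous precision because ⟨A⇒A⟩
    -- is equiprecise to the identity.
    exact ⟨.pi ih.1 hB hB fun x y h => hB x y (G.trans (A := c.bundle) ih.1 h.1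
        (G.cast_id (A := c.bundle) ih.1 h.2).1),
      .pi ih.2 hB' hB' fun x y h => hB' x y (G.trans (A := c'.bundle) ih.2 h.1
        (G.cast_id (A := c'.bundle) ih.2 h.2).1)⟩
  | err_refl => exact ⟨.err_refl, .err_refl⟩
  | err_min h => exact ⟨.err_refl, h⟩
  | unk_refl => exact ⟨.unk_refl, .unk_refl⟩
  | prop h => exact ⟨.prop h, .prop h⟩
  | prop_unk h => exact ⟨.prop h, .unk_refl⟩
  | box h p q => exact ⟨.box h p p, .box h q q⟩
  | univ h => exact ⟨.univ h, .univ h⟩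
  | univ_unk h => exact ⟨.univ h, .unk_refl⟩
  | cum h => exact ⟨.cum (LG.tquasi h).1, .cum (LG.tquasi h).2⟩
  | cum_unk h => exact ⟨.cum h, .unk_refl⟩

/-! ### The hierarchy -/

/-- The laws of a universe. -/
structure LevelGood (L : Level.{u, v}) : Prop where
  good : Good L.toPreLevel fun A => L.tprec A A
  tquasi : ∀ {A B}, L.tprec A B → L.tprec A A ∧ L.tprec B B
  errCode_le : ∀ {A}, L.tprec A A → L.tprec L.errCode A
  unkCode_self : L.tprec L.unkCode L.unkCode

namespace LevelGood

variable {L : Level.{u, v}} (H : LevelGood L)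
include H

theorem ttrans {A B C : L.U} (h : L.tprec A B) (h' : L.tprec B C) : L.tprec A C :=
  H.good.ttrans (H.tquasi h).1 (H.tquasi h).2 (H.tquasi h').2 h h'

theorem tprec_isPartialPreorder : IsPartialPreorder L.tprec where
  trans _ _ _ h h' := H.ttrans h h'
  left_refl _ _ h := (H.tquasi h).1
  right_refl _ _ h := (H.tquasi h).2

theorem uprec_isPartialPreorder : IsPartialPreorder L.uprec where
  trans _ _ _ h h' := ⟨H.ttrans h.1 h'.1, h'.2⟩
  left_refl _ _ h := ⟨(H.tquasi h.1).1, H.ttrans h.1 h.2⟩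
  right_refl _ _ h := ⟨(H.tquasi h.1).2, h.2⟩

theorem uprec_errCode {A : L.U} (h : L.uprec A A) : L.uprec L.errCode A :=
  ⟨H.errCode_le h.1, h.2⟩

theorem isGreatestElt_unkCode : IsGreatestElt L.uprec L.unkCode :=
  ⟨⟨H.unkCode_self, H.unkCode_self⟩, fun _ h => ⟨h.2, H.unkCode_self⟩⟩

/-- Every condition on casts is inherited by a relation contained in type precision, so this covers
type and term precision at once. -/
theorem isIndexedPartialPreorder {r : L.U → L.U → Prop} (hr : IsPartialPreorder r)
    (hle : ∀ A B, r A B → L.tprec A B) :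
    IsIndexedPartialPreorder r L.El L.prec L.cast fun A B => L.cast B A where
  base := hr
  fibre A hA :=
    { trans _ _ _ h h' := H.good.trans (hle _ _ hA) h h'
      left_refl _ _ h := H.good.left (hle _ _ hA) h
      right_refl _ _ h := H.good.right (hle _ _ hA) h }
  epPair A B h :=
    have h := hle _ _ h
    H.good.isEPPair (H.tquasi h).1 (H.tquasi h).2 h
  up_id A hA b hb := H.good.cast_id (hle _ _ hA) hb
  down_id A hA b hb := (H.good.cast_id (hle _ _ hA) hb).symm
  up_comp A B C h h' b hb := by
    have h := hle _ _ h
    have h' := hle _ _ h'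
    obtain ⟨hA, hB⟩ := H.tquasi h
    exact ⟨H.good.lax hA hB (H.tquasi h').2 hb, H.good.up hA hB (H.tquasi h').2 h hb⟩
  down_comp A B C h h' b hb := by
    have h := hle _ _ h
    have hC := (H.tquasi (hle _ _ h')).2
    obtain ⟨hA, hB⟩ := H.tquasi h
    exact ⟨H.good.lax hC hB hA hb, H.good.down hA hB hC h hb⟩

theorem copy {V : Type w} (e : V ≃ L.U) : LevelGood (L.copy e) where
  good :=
    { tself hA := hA
      ttrans hA hB hC := H.good.ttrans hA hB hC
      trans hA := H.good.trans hA
      quasi hA := H.good.quasi hA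
      err_le hA := H.good.err_le hA
      le_unk hA := H.good.le_unk hA
      unk_self hA := H.good.unk_self hA
      mono hA hB := H.good.mono hA hB
      cast_err hA hB := H.good.cast_err hA hB
      lax hA hB hC := H.good.lax hA hB hC
      up hA hB hC := H.good.up hA hB hC
      down hA hB hC := H.good.down hA hB hC
      cast_id hA := H.good.cast_id hA }
  tquasi h := H.tquasi h
  errCode_le {A} h := by
    change L.tprec (e (e.symm L.errCode)) (e A)
    rw [e.apply_symm_apply]
    exact H.errCode_le h
  unkCode_self := by
    change L.tprec (e (e.symm L.unkCode)) (e (e.symm L.unkCode))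
    rw [e.apply_symm_apply]
    exact H.unkCode_self

end LevelGood

theorem LowGood.none : LowGood.{u} none where
  good := by constructor <;> exact fun {A} => A.elim
  tquasi {A} := A.elim
  uprec_trans {A} := A.elim
  uprec_quasi {A} := A.elim
  err_le _ {A} := A.elim
  le_unk _ {A} := A.elim
  unk_self h := by cases h

theorem LowGood.some {L : Level.{u, u}} (H : LevelGood L) : LowGood (some L) where
  good := H.good
  tquasi h := H.tquasi h
  uprec_trans h h' := H.uprec_isPartialPreorder.trans _ _ _ h h'
  uprec_quasi h :=
    ⟨H.uprec_isPartialPreorder.left_refl _ _ h, H.uprec_isPartialPreorder.right_refl _ _ h⟩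
  err_le _ _ h := H.uprec_errCode h
  le_unk _ _ h := H.isGreatestElt_unkCode.2 _ h
  unk_self _ := H.isGreatestElt_unkCode.1

theorem LowGood.next (LG : LowGood P) : LevelGood (next P) where
  good := good_next LG
  tquasi h := h.quasi LG
  errCode_le h := .err_min h
  unkCode_self := .unk_refl

theorem lowGood_below (i : ℕ) : LowGood (below.{u} i) := by
  induction i with
  | zero => exact .none
  | succ j ih =>
    rw [below]
    split
    -- The laws transfer to the copy of the preceding universe; in the other branch there are no
    -- lower types and they hold vacuously.
    · exact .some (ih.next.copy _)
    · exact .none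

theorem levelGood_level (i : ℕ) : LevelGood (level.{u} i) := (lowGood_below i).next

end Grip

theorem mainTheorem4 (i : ℕ) (hsmall : ∀ j < i, Small.{u} (Grip.Univ.{u} j)) :
    Grip.IsPartialPreorder (Grip.typePrec : Grip.Univ.{u} i → Grip.Univ.{u} i → Prop) ∧
    Grip.IsPartialPreorder (Grip.termPrec : Grip.Univ.{u} i → Grip.Univ.{u} i → Prop) ∧
    Grip.IsIndexedPartialPreorder
      (Grip.typePrec : Grip.Univ.{u} i → Grip.Univ.{u} i → Prop)
      (fun A => Grip.El A) (fun A => Grip.prec A)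
      (fun A B => Grip.cast A B) (fun A B => Grip.cast B A) ∧
    Grip.IsIndexedPartialPreorder
      (Grip.termPrec : Grip.Univ.{u} i → Grip.Univ.{u} i → Prop)
      (fun A => Grip.El A) (fun A => Grip.prec A)
      (fun A B => Grip.cast A B) (fun A B => Grip.cast B A) ∧
    Grip.IsGreatestElt (Grip.termPrec : Grip.Univ.{u} i → Grip.Univ.{u} i → Prop)
      (Grip.unknown.{u} i) := by
  have H := Grip.levelGood_level.{u} i
  exact ⟨H.tprec_isPartialPreorder, H.uprec_isPartialPreorder,
    H.isIndexedPartialPreorder H.tprec_isPartialPreorder fun _ _ h => h,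
    H.isIndexedPartialPreorder H.uprec_isPartialPreorder fun _ _ h => h.1,
    H.isGreatestElt_unkCode⟩
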